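/- \textbf{The game.} Let $k\ge 2$ be an integer and $\alpha>0$. In local-knowledge SumNCG on a finite set $V$ of $n$ players, each player $u$ plays a set $\sigma_u\subseteq V\setminus\{u\}$. The network $G(\sigma)$ is the undirected graph on $V$ with edge set $\{\{u,v\}: v\in\sigma_u\}$, and the cost of $u$ is $C_u(\sigma)=\alpha|\sigma_u|+\sum_{v\in V}d_{G(\sigma)}(u,v)$ (with $d=\infty$ between different components). The view of $u$ is the subgraph of $G(\sigma)$ induced by the vertices at distance at most $k$ from $u$ (her $k$-neighborhood); she knows only $k$, her view and $\sigma_u$, and not $n$. For a subset $\sigma'_u$ of her $k$-neighborhood with $u\notin\sigma'_u$ let $$\Delta(\sigma_u,\sigma'_u)=\sup_{\tau}\,\bigl\{C_u(\tau_{-u},\sigma'_u)-C_u(\tau)\bigr\},$$ where $\tau$ ranges over all strategy profiles with $\tau_u=\sigma_u$, on all finite player sets containing the $k$-neighborhood of $u$, whose network $G(\tau)$ is connected and gives $u$ the same view as $G(\sigma)$. A local knowledge equilibrium (LKE) is a profile $\sigma$ with $G(\sigma)$ connected such that $\Delta(\sigma_u,\sigma'_u)\ge 0$ for every player $u$ and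 every such $\sigma'_u$. The social cost of a profile is $\sum_{u}C_u(\sigma)$, and the price of anarchy (PoA) is the maximum of the social cost over all LKEs, divided by the minimum of the social cost over all strategy profiles on $V$. \textbf{Theorem.} There is an absolute constant $c>0$ such that for all integers $k\ge 2$ and $n\ge 2$ and every real $\alpha\ge kn$, the PoA of local-knowledge SumNCG with $n$ players and parameters $k$ and $\alpha$ is at least $c\,n^{\frac{1}{2k-2}}$. -/

import Mathlib

open scoped NNReal ENNReal

namespace SumNCG

/-- A strategy profile: `σ u` is the finite set of players towards which `u` buys an edge. -/
abbrev Profile (V : Type) := V → Finset V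

/-- Player `u` chooses a subset of `V \ {u}`. -/
def Profile.IsLegal {V : Type} (σ : Profile V) : Prop := ∀ u, u ∉ σ u

/-- The undirected network `G(σ)`: `u` and `v` are adjacent iff one of them bought the edge. -/
def network {V : Type} (σ : Profile V) : SimpleGraph V :=
  SimpleGraph.fromRel fun u v => v ∈ σ u

/-- The vertices at distance at most `k` from `u`. -/
def kNeighborhood {V : Type} (G : SimpleGraph V) (k : ℕ) (u : V) : Set V :=
  {v | G.edist u v ≤ (k : ℕ∞)}

/-- The cost `α |σ_u| + ∑ v, d(u, v)`; it is `∞` if some player cannot be reached from `u`. -/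
noncomputable def cost {V : Type} [Fintype V] (α : ℝ≥0) (σ : Profile V) (u : V) : ℝ≥0∞ :=
  (α : ℝ≥0∞) * ((σ u).card : ℝ≥0∞) + ∑ v, ((network σ).edist u v : ℝ≥0∞)

open Classical in
/-- The profile `(σ_{-u}, S)`. -/
noncomputable def deviate {V : Type} (σ : Profile V) (u : V) (S : Finset V) : Profile V :=
  Function.update σ u S

open Classical in
/-- The profile `τ` on the player set `W` is compatible with what `u` knows in `σ`: its network is
connected, `u` plays the same strategy, and the view of `u`, that is, the subgraph induced by the
`k`-neighborhood of `u`, is the same. The identification of the visible players with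
players in `W` is the restriction of `ι` to the `k`-neighborhood; the other values of `ι` play no
role. The set `W` may have any finite size, since players do not know the size of the network. -/
structure IsRealization {V W : Type} (k : ℕ) (σ : Profile V) (u : V)
    (τ : Profile W) (ι : V → W) : Prop where
  legal : τ.IsLegal
  connected : (network τ).Connected
  injOn : Set.InjOn ι (kNeighborhood (network σ) k u)
  image_eq : ι '' kNeighborhood (network σ) k u = kNeighborhood (network τ) k (ι u)
  adj_iff : ∀ a ∈ kNeighborhood (network σ) k u, ∀ b ∈ kNeighborhood (network σ) k u,
    (network τ).Adj (ι a) (ι b) ↔ (network σ).Adj a b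
  strategy_eq : τ (ι u) = (σ u).image ι

open Classical in
/-- The worst-case change of the cost of `u` when she switches from `σ u` to `S`: the supremum of
`C_u(τ_{-u}, S) - C_u(τ)` over all profiles `τ` that are compatible with her view. The subtracted
cost is always finite, because the network of `τ` is connected. -/
noncomputable def worstCaseChange {V : Type} (k : ℕ) (α : ℝ≥0) (σ : Profile V) (u : V)
    (S : Finset V) : EReal :=
  sSup {x : EReal | ∃ (W : Type) (_ : Fintype W) (τ : Profile W) (ι : V → W),
    IsRealization k σ u τ ι ∧
      x = (cost α (deviate τ (ι u) (S.image ι)) (ι u) : EReal) - (cost α τ (ι u) : EReal)}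

/-- Local knowledge equilibrium on a connected network: no player has a strategy inside her
`k`-neighborhood that is an improvement in the worst case. -/
structure IsLKE {V : Type} (k : ℕ) (α : ℝ≥0) (σ : Profile V) : Prop where
  legal : σ.IsLegal
  connected : (network σ).Connected
  stable : ∀ (u : V) (S : Finset V), u ∉ S →
    (S : Set V) ⊆ kNeighborhood (network σ) k u → 0 ≤ worstCaseChange k α σ u S

/-- The sum of the costs of all players. -/
noncomputable def socialCost {V : Type} [Fintype V] (α : ℝ≥0) (σ : Profile V) : ℝ≥0∞ :=
  ∑ u, cost α σ u

/-- The least social cost of any strategy profile. -/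
noncomputable def optimalCost (V : Type) [Fintype V] (α : ℝ≥0) : ℝ≥0∞ :=
  ⨅ (σ : Profile V) (_ : σ.IsLegal), socialCost α σ

/-- The price of anarchy: the largest ratio of the social cost of an equilibrium to the optimal
social cost. -/
noncomputable def priceOfAnarchy (V : Type) [Fintype V] (k : ℕ) (α : ℝ≥0) : ℝ≥0∞ :=
  ⨆ (σ : Profile V) (_ : IsLKE k α σ), socialCost α σ / optimalCost V α

end SumNCG

/-! Since `α ≥ kn`, distances are negligible at the optimum: a star costs at most `2αn`. It
therefore suffices to find an equilibrium in which the players together buy of order `n^(1 +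
1/(2k-2))` edges.

Stability (`IsGood.isLKE`). Let the network be connected and bipartite without cycles shorter than
`2k`, and let every bought edge `u → w` have two clean continuations `y`, that is, neighbours `y ≠
u` of `w` such that `u, w, y` lies on no `2k`-cycle. In the view of `u`, the branch behind a clean
`y` hangs on the single edge `wy`, and different branches are disjoint. A larger strategy costs at
least `α` more, which outweighs all distances if the visible network is everything. A different
strategy that is not larger gives up some `w` and misses a whole branch behind it, because each
dropped edge would have to be replaced by two new ones. Then `u` must fear that very many unseen
players hang at a vertex of that branch at distance `k`: they move from distance `k+1` to at least
`k+2`.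

Density (`exists_dense`). Among bipartite graphs of maximum degree at most `D = 16T` without cycles
shorter than `2k`, take one that maximizes `T` times the number of edges minus the number of
`2k`-cycles. Deleting an edge does not help, so each edge closes at most `T` paths to `2k`-cycles.
Adding one does not help either, so a vertex of degree below `D` has at most of order `kD^(2k-2)`
deficient vertices in the other class. Tolerating `2k`-cycles at the price `T` is what turns the
greedy bound `D^(2k-1)` into `D^(2k-2)`. So `T` can be of order `n^(1/(2k-2))`.

A subgraph of minimum degree `T+3` (`exists_core`) supplies the clean continuations whichever way
its edges are oriented, and bridges into it make the network connected (`IsGood.exists_connected`).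
-/

namespace SumNCG

/-! ### Counting cycles under insertion and deletion of an edge. -/

variable {V : Type}

/-- The closed `m`-cycles of `G`, with a base point and an orientation. -/
def cyc (G : SimpleGraph V) (m : ℕ) : Set (ZMod m → V) :=
  {f | Function.Injective f ∧ ∀ i, G.Adj (f i) (f (i + 1))}

/-- The paths of `G` on `m` vertices from `b` to `a`, indexed so that the pair `(a, b)` would
close them up to an `m`-cycle. -/
def arc (G : SimpleGraph V) (m : ℕ) (a b : V) : Set (ZMod m → V) :=
  {f | Function.Injective f ∧ f (-1) = a ∧ f 0 = b ∧ ∀ i, i ≠ -1 → G.Adj (f i) (f (i + 1))}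

theorem cyc_mono {G H : SimpleGraph V} (h : G ≤ H) (m : ℕ) : cyc G m ⊆ cyc H m :=
  fun _ hf => ⟨hf.1, fun i => h (hf.2 i)⟩

theorem one_ne_neg_one_zmod {m : ℕ} (hm : 3 ≤ m) : (1 : ZMod m) ≠ -1 := by
  intro h
  have h2 : ((2 : ℕ) : ZMod m) = 0 := by
    push_cast
    have : (1 : ZMod m) + 1 = 0 := by nth_rewrite 1 [h]; simp
    rw [← this]; norm_num
  rw [ZMod.natCast_eq_zero_iff] at h2
  have := Nat.le_of_dvd (by norm_num) h2
  omega

/-- A new cycle uses the new edge exactly once, so rotating that step to the position `(-1, 0)`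
leaves an arc of the old graph. For `m = 2` the cycle could traverse the edge back and forth, hence
`3 ≤ m`. -/
theorem arc_rotate_of_cyc_sup_edge {G : SimpleGraph V} {a b : V} {m : ℕ} (hm : 3 ≤ m)
    {f : ZMod m → V} (hf : f ∈ cyc (G ⊔ SimpleGraph.edge a b) m) (hG : f ∉ cyc G m) :
    ∃ i : ZMod m, (fun j => f (j + i)) ∈ arc G m a b ∨ (fun j => f (j + i)) ∈ arc G m b a := by
  obtain ⟨hinj, hadj⟩ := hf
  have : ∃ i, ¬ G.Adj (f i) (f (i + 1)) := by
    by_contra! h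
    exact hG ⟨hinj, h⟩
  obtain ⟨i, hi⟩ := this
  have key : ∀ x y : V, f i = x → f (i + 1) = y →
      (∀ p q, (G ⊔ SimpleGraph.edge a b).Adj p q → ¬ G.Adj p q → p = x ∧ q = y ∨ p = y ∧ q = x) →
      (fun j => f (j + (i + 1))) ∈ arc G m x y := by
    intro x y hx hy hxy
    refine ⟨fun p q h => by simpa using hinj h, by simpa using hx, by simpa using hy, ?_⟩
    intro j hj
    by_contra hn
    have h1 := hadj (j + (i + 1))
    have hn' : ¬ G.Adj (f (j + (i + 1))) (f (j + (i + 1) + 1)) := by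
      convert hn using 3; ring
    rcases hxy _ _ h1 hn' with ⟨h, -⟩ | ⟨h, h'⟩
    · rw [← hx] at h
      have := hinj h
      apply hj
      have : j + 1 = 0 := by linear_combination this
      linear_combination this
    · rw [← hy] at h
      rw [← hx] at h'
      have e1 := hinj h
      have e2 := hinj h'
      apply one_ne_neg_one_zmod hm
      linear_combination e2 - e1
  have hi' := hadj i
  have hedge : ∀ p q, (G ⊔ SimpleGraph.edge a b).Adj p q → ¬ G.Adj p q →
      p = a ∧ q = b ∨ p = b ∧ q = a := by
    intro p q h h'
    rw [SimpleGraph.sup_adj, SimpleGraph.edge_adj] at h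
    rcases h with h | h
    · exact absurd h h'
    · exact h.1
  rcases hedge _ _ hi' hi with ⟨h1, h2⟩ | ⟨h1, h2⟩
  · exact ⟨i + 1, Or.inl (key a b h1 h2 hedge)⟩
  · exact ⟨i + 1, Or.inr (key b a h1 h2 fun p q h h' => (hedge p q h h').symm)⟩

theorem arc_reverse {G : SimpleGraph V} {a b : V} {m : ℕ} {f : ZMod m → V}
    (hf : f ∈ arc G m a b) : (fun i => f (-1 - i)) ∈ arc G m b a := by
  obtain ⟨h1, h2, h3, h4⟩ := hf
  refine ⟨fun p q h => by simpa using h1 h, by simpa using h3, by simpa using h2, ?_⟩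
  intro i hi
  have := (h4 (-1 - (i + 1)) (fun h => hi (by linear_combination -h))).symm
  convert this using 2
  ring

theorem ncard_arc_comm {G : SimpleGraph V} [Finite V] {a b : V} {m : ℕ} [NeZero m] :
    (arc G m a b).ncard ≤ (arc G m b a).ncard := by
  refine Set.ncard_le_ncard_of_injOn (fun f i => f (-1 - i)) (fun f hf => arc_reverse hf) ?_
    (Set.toFinite _)
  intro f _ g _ h
  funext i
  have := congrFun h (-1 - i)
  simpa using this

/-- Adding one edge creates few cycles. -/
theorem ncard_cyc_sup_edge_le [Finite V] (G : SimpleGraph V) (a b : V) {m : ℕ} [NeZero m]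
    (hm : 3 ≤ m) : (cyc (G ⊔ SimpleGraph.edge a b) m).ncard ≤
      (cyc G m).ncard + 2 * m * (arc G m a b).ncard := by
  classical
  have hsub : cyc (G ⊔ SimpleGraph.edge a b) m ⊆ cyc G m ∪
      ⋃ i ∈ (Finset.univ : Finset (ZMod m)), (fun f : ZMod m → V => fun j => f (j - i)) ''
        (arc G m a b ∪ arc G m b a) := by
    intro f hf
    by_cases hG : f ∈ cyc G m
    · exact Or.inl hG
    · right
      obtain ⟨i, hi⟩ := arc_rotate_of_cyc_sup_edge hm hf hG
      simp only [Set.mem_iUnion]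
      exact ⟨i, Finset.mem_univ _, _, hi, by funext j; simp⟩
  have hone : ∀ i ∈ (Finset.univ : Finset (ZMod m)),
      ((fun f : ZMod m → V => fun j => f (j - i)) '' (arc G m a b ∪ arc G m b a)).ncard ≤
        2 * (arc G m a b).ncard := by
    intro i _
    refine (Set.ncard_image_le (Set.toFinite _)).trans ((Set.ncard_union_le _ _).trans ?_)
    have := ncard_arc_comm (G := G) (a := b) (b := a) (m := m)
    omega
  calc _ ≤ _ := Set.ncard_le_ncard hsub (Set.toFinite _)
    _ ≤ _ := Set.ncard_union_le _ _
    _ ≤ _ := by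
      gcongr
      refine (Finset.set_ncard_biUnion_le _ _).trans ((Finset.sum_le_sum hone).trans ?_)
      simp [ZMod.card]
      apply le_of_eq; ring

/-- Every edge that closes an arc accounts for cycles that its deletion destroys. -/
theorem ncard_cyc_deleteEdge_add_arc_le [Finite V] (G : SimpleGraph V) {u w : V} (h : G.Adj u w)
    {m : ℕ} [NeZero m] :
    (cyc (G.deleteEdges {s(u, w)}) m).ncard + (arc G m u w).ncard ≤ (cyc G m).ncard := by
  rw [← Set.ncard_union_eq _ (Set.toFinite _) (Set.toFinite _)]
  · apply Set.ncard_le_ncard _ (Set.toFinite _)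
    rintro f (hf | ⟨h1, h2, h3, h4⟩)
    · exact cyc_mono (SimpleGraph.deleteEdges_le _) m hf
    · refine ⟨h1, fun i => ?_⟩
      -- The step from index `-1` to `0` is the one that the edge `uw` closes. Only this position
      -- and direction are counted, so the bound ignores the other rotations and the reversals.
      by_cases hi : i = -1
      · subst hi; simpa [h2, h3] using h
      · exact h4 i hi
  · rw [Set.disjoint_left]
    rintro f ⟨-, hf⟩ ⟨-, h2, h3, -⟩
    have := hf (-1)
    simp [h2, h3] at this

theorem ncard_walks_le [Finite V] (G : SimpleGraph V) {D : ℕ}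
    (hD : ∀ v, (G.neighborSet v).ncard ≤ D) (a : V) (m : ℕ) :
    {f : Fin (m + 1) → V | f 0 = a ∧ ∀ i : Fin m, G.Adj (f i.castSucc) (f i.succ)}.ncard
      ≤ D ^ m := by
  classical
  have := Fintype.ofFinite V
  induction m with
  | zero =>
    rw [pow_zero, Set.ncard_le_one_iff]
    rintro f g ⟨hf, -⟩ ⟨hg, -⟩
    funext i
    obtain rfl : i = 0 := Fin.fin_one_eq_zero i
    rw [hf, hg]
  | succ m ih =>
    rw [Set.ncard_eq_toFinset_card'] at ih ⊢
    refine (Finset.card_le_mul_card_image_of_maps_to (f := fun f => Fin.init f) ?_ D ?_).trans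
      ((Nat.mul_le_mul_left D ih).trans (by rw [pow_succ, mul_comm]))
    · intro f hf
      simp only [Set.mem_ofPred_eq, Set.mem_toFinset] at hf ⊢
      exact ⟨hf.1, fun i => hf.2 i.castSucc⟩
    · intro g hg
      refine le_trans ?_ (hD (g (Fin.last m)))
      rw [← Set.ncard_coe_finset]
      refine Set.ncard_le_ncard_of_injOn (fun f => f (Fin.last (m + 1))) ?_ ?_ (Set.toFinite _)
      · intro f hf
        simp only [Finset.coe_filter, Set.mem_toFinset, Set.mem_ofPred_eq] at hf
        obtain ⟨⟨-, h⟩, rfl⟩ := hf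
        simpa [Fin.init] using h (Fin.last m)
      · intro f hf f' hf' h
        simp only [Finset.coe_filter, Set.mem_toFinset, Set.mem_ofPred_eq] at hf hf'
        rw [← Fin.snoc_init_self f, ← Fin.snoc_init_self f', hf.2, hf'.2]
        simp only at h
        rw [h]

theorem ncard_arcs_from_le [Finite V] (G : SimpleGraph V) {D : ℕ}
    (hD : ∀ v, (G.neighborSet v).ncard ≤ D) (a : V) (m : ℕ) :
    {f : ZMod (m + 1) → V | f 0 = a ∧ ∀ i, i ≠ -1 → G.Adj (f i) (f (i + 1))}.ncard ≤ D ^ m := by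
  refine le_trans (Set.ncard_le_ncard ?_ (Set.toFinite _)) (ncard_walks_le G hD a m)
  rintro f ⟨h1, h2⟩
  refine ⟨h1, fun i => ?_⟩
  have h4 : (i.castSucc : ZMod (m + 1)) + 1 = i.succ := Fin.coeSucc_eq_succ
  have h3 : (i.castSucc : ZMod (m + 1)) ≠ -1 := by
    intro h
    rw [h, neg_add_cancel] at h4
    exact Fin.succ_ne_zero i h4.symm
  convert h2 i.castSucc h3 using 2
  exact (congrArg f h4).symm

theorem reachable_of_mem_arc {G : SimpleGraph V} {m : ℕ} {a b : V} {f : ZMod m → V}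
    (hm : m ≠ 0) (hf : f ∈ arc G m a b) : G.Reachable b a := by
  obtain ⟨-, h1, h2, h3⟩ := hf
  have : ∀ j : ℕ, j < m → G.Reachable b (f j) := by
    intro j hj
    induction j with
    | zero => simp [h2]
    | succ j ih =>
      refine (ih (by omega)).trans ?_
      push_cast
      refine (h3 _ ?_).reachable
      intro h
      have : ((j + 1 : ℕ) : ZMod m) = 0 := by push_cast; rw [h]; ring
      rw [ZMod.natCast_eq_zero_iff] at this
      exact absurd (Nat.le_of_dvd (by omega) this) (by omega)
  have h := this (m - 1) (by omega)
  rw [Nat.cast_sub (by omega)] at h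
  simpa [h1] using h

/-- A bridge lies on no cycle: an arc would already join its ends. -/
theorem cyc_sup_edge_of_not_reachable {G : SimpleGraph V} {m : ℕ} {a b : V} (hm : 3 ≤ m)
    (h : ¬ G.Reachable a b) : cyc (G ⊔ SimpleGraph.edge a b) m ⊆ cyc G m := by
  intro f hf
  by_contra hG
  obtain ⟨i, hi | hi⟩ := arc_rotate_of_cyc_sup_edge hm hf hG
  · exact h (reachable_of_mem_arc (by omega) hi).symm
  · exact h (reachable_of_mem_arc (by omega) hi)

end SumNCG

/-! ### Dense graphs with few shortest cycles through every edge. -/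

namespace SumNCG

variable {V : Type}

/-- Every graph has a subgraph of large minimum degree that contains most of its edges. -/
theorem exists_core [Finite V] (G : SimpleGraph V) (d : ℕ) :
    ∃ (H : SimpleGraph V) (Z : Set V), H ≤ G ∧ (∀ u v, H.Adj u v → u ∈ Z) ∧
      (∀ v ∈ Z, d ≤ (H.neighborSet v).ncard) ∧
      G.edgeSet.ncard ≤ H.edgeSet.ncard + Nat.card V * d := by
  classical
  let R : Set V → SimpleGraph V := fun Z =>
    { Adj := fun u v => G.Adj u v ∧ u ∈ Z ∧ v ∈ Z
      symm := ⟨fun u v h => ⟨h.1.symm, h.2.2, h.2.1⟩⟩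
      loopless := ⟨fun u h => G.loopless.irrefl u h.1⟩ }
  -- Each discarded vertex is rewarded with `d`, so removing a vertex of degree less than `d` from
  -- the maximizer would raise the value. Comparison with `Set.univ` gives the edge count.
  obtain ⟨Z, hZ⟩ := Finite.exists_max (fun Z : Set V => (R Z).edgeSet.ncard + Zᶜ.ncard * d)
  refine ⟨R Z, Z, fun u v h => h.1, fun u v h => h.2.1, ?_, ?_⟩
  · intro v hv
    by_contra! hlt
    have h1 := hZ (Z \ {v})
    have h2 : (R Z).edgeSet ⊆ (R (Z \ {v})).edgeSet ∪
        (fun w => s(v, w)) '' (R Z).neighborSet v := by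
      intro e
      induction e using Sym2.ind with
      | _ x y =>
        intro h
        by_cases hx : x = v
        · exact Or.inr ⟨y, hx ▸ h, by rw [hx]⟩
        by_cases hy : y = v
        · exact Or.inr ⟨x, by subst hy; exact (R Z).symm.symm _ _ h, by rw [hy, Sym2.eq_swap]⟩
        · exact Or.inl ⟨h.1, ⟨h.2.1, hx⟩, ⟨h.2.2, hy⟩⟩
    have h3 := (Set.ncard_le_ncard h2 (Set.toFinite _)).trans (Set.ncard_union_le _ _)
    have h4 := Set.ncard_image_le (f := fun w => s(v, w)) (Set.toFinite ((R Z).neighborSet v))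
    have h5 : (Z \ {v})ᶜ = insert v Zᶜ := by
      ext x; by_cases hx : x = v <;> simp [hx]
    have h6 : ((Z \ {v})ᶜ).ncard = Zᶜ.ncard + 1 := by
      rw [h5, Set.ncard_insert_of_notMem (by simpa using hv) (Set.toFinite _)]
    simp only [h6] at h1
    rw [add_mul, one_mul] at h1
    omega
  · have h1 := hZ Set.univ
    have h2 : (R Set.univ) = G := by
      ext u v; simp [R]
    simp only [h2] at h1
    have h3 : Zᶜ.ncard * d ≤ Nat.card V * d := by
      gcongr
      rw [← Set.ncard_univ]
      exact Set.ncard_le_ncard (Set.subset_univ _) (Set.toFinite _)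
    omega

/-- The set `F` lies in one colour class, so no edge is counted from both of its ends. -/
theorem mul_ncard_le_ncard_edgeSet [Finite V] {G : SimpleGraph V} {c : V → Bool}
    (hc : ∀ u v, G.Adj u v → c u ≠ c v) {F : Set V} {s : Bool} (hF : ∀ v ∈ F, c v = s) {D : ℕ}
    (hD : ∀ v ∈ F, D ≤ (G.neighborSet v).ncard) : D * F.ncard ≤ G.edgeSet.ncard := by
  classical
  have := Fintype.ofFinite V
  have h1 : D * F.ncard ≤ {p : V × V | p.1 ∈ F ∧ G.Adj p.1 p.2}.ncard := by
    rw [Set.ncard_eq_toFinset_card' F, Set.ncard_eq_toFinset_card']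
    refine Finset.mul_card_image_le_card_of_maps_to (f := Prod.fst) ?_ D ?_
    · intro p hp; simp_all
    · intro v hv
      rw [Set.mem_toFinset] at hv
      refine (hD v hv).trans ?_
      rw [← Set.ncard_coe_finset]
      refine Set.ncard_le_ncard_of_injOn (fun w => (v, w)) ?_ ?_ (Set.toFinite _)
      · intro w hw; simpa [hv] using hw
      · intro w _ w' _ h; simpa using h
  refine h1.trans (Set.ncard_le_ncard_of_injOn (fun p => s(p.1, p.2)) ?_ ?_ (Set.toFinite _))
  · intro p hp; exact hp.2
  · rintro ⟨x, y⟩ ⟨hx, hxy⟩ ⟨x', y'⟩ ⟨hx', hxy'⟩ h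
    simp only [Sym2.eq_iff] at h
    rcases h with ⟨rfl, rfl⟩ | ⟨rfl, rfl⟩
    · rfl
    · exact absurd ((hF _ hx).trans (hF _ hx').symm) (hc _ _ hxy)

/-- The bipartite graphs of bounded degree without short cycles. -/
structure Admissible (c : V → Bool) (k D : ℕ) (G : SimpleGraph V) : Prop where
  bip : ∀ u v, G.Adj u v → c u ≠ c v
  deg : ∀ v, (G.neighborSet v).ncard ≤ D
  girth : ∀ j, 2 ≤ j → j < k → cyc G (2 * j) = ∅

theorem Admissible.mono [Finite V] {c : V → Bool} {k D : ℕ} {G H : SimpleGraph V}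
    (hG : Admissible c k D G) (h : H ≤ G) : Admissible c k D H where
  bip u v hu := hG.bip u v (h hu)
  deg v := (Set.ncard_le_ncard (fun _ hx => h hx) (Set.toFinite _)).trans (hG.deg v)
  girth j h1 h2 := Set.subset_eq_empty (cyc_mono h _) (hG.girth j h1 h2)

theorem Admissible.sup_edge [Finite V] {c : V → Bool} {k D : ℕ} {G : SimpleGraph V}
    (hG : Admissible c k D G) {a b : V} (hab : c a ≠ c b)
    (ha : (G.neighborSet a).ncard < D) (hb : (G.neighborSet b).ncard < D)
    (harc : ∀ j, 2 ≤ j → j < k → arc G (2 * j) a b = ∅) :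
    Admissible c k D (G ⊔ SimpleGraph.edge a b) where
  bip u v h := by
    rw [SimpleGraph.sup_adj, SimpleGraph.edge_adj] at h
    rcases h with h | ⟨⟨rfl, rfl⟩ | ⟨rfl, rfl⟩, -⟩
    · exact hG.bip u v h
    · exact hab
    · exact hab.symm
  deg v := by
    by_cases hva : v = a
    · subst hva
      have : (G ⊔ SimpleGraph.edge v b).neighborSet v ⊆ insert b (G.neighborSet v) := by
        intro x hx
        simp only [SimpleGraph.mem_neighborSet, SimpleGraph.sup_adj, SimpleGraph.edge_adj] at hx
        rcases hx with hx | ⟨⟨-, rfl⟩ | ⟨h, rfl⟩, -⟩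
        · exact Or.inr hx
        · exact Or.inl rfl
        · exact Or.inl h
      have := (Set.ncard_le_ncard this (Set.toFinite _)).trans (Set.ncard_insert_le _ _)
      omega
    by_cases hvb : v = b
    · subst hvb
      have : (G ⊔ SimpleGraph.edge a v).neighborSet v ⊆ insert a (G.neighborSet v) := by
        intro x hx
        simp only [SimpleGraph.mem_neighborSet, SimpleGraph.sup_adj, SimpleGraph.edge_adj] at hx
        rcases hx with hx | ⟨⟨h, rfl⟩ | ⟨-, rfl⟩, -⟩
        · exact Or.inr hx
        · exact Or.inl h
        · exact Or.inl rfl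
      have := (Set.ncard_le_ncard this (Set.toFinite _)).trans (Set.ncard_insert_le _ _)
      omega
    · refine le_trans (Set.ncard_le_ncard ?_ (Set.toFinite _)) (hG.deg v)
      intro x hx
      simp only [SimpleGraph.mem_neighborSet, SimpleGraph.sup_adj, SimpleGraph.edge_adj] at hx
      rcases hx with hx | ⟨⟨h, -⟩ | ⟨h, -⟩, -⟩
      · exact hx
      · exact absurd h hva
      · exact absurd h hvb
  girth j h1 h2 := by
    rw [Set.eq_empty_iff_forall_notMem]
    intro f hf
    have : NeZero (2 * j) := ⟨by omega⟩
    obtain ⟨i, hi | hi⟩ := arc_rotate_of_cyc_sup_edge (by omega) hf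
      (by rw [hG.girth j h1 h2]; exact Set.notMem_empty f)
    · rw [harc j h1 h2] at hi; exact hi
    · have := arc_reverse hi
      rw [harc j h1 h2] at this; exact this

/-- An admissible graph in which every edge lies on few `2k`-cycles, and such that every further
edge would break admissibility or create many `2k`-cycles. -/
theorem exists_extremal [Finite V] (c : V → Bool) {k : ℕ} (hk : 2 ≤ k) (D T : ℕ) :
    ∃ G, Admissible c k D G ∧ (∀ u w, G.Adj u w → (arc G (2 * k) u w).ncard ≤ T) ∧
      ∀ a b, c a ≠ c b → (G.neighborSet a).ncard < D → (G.neighborSet b).ncard < D →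
        G.Adj a b ∨ (∃ j, 2 ≤ j ∧ j < k ∧ (arc G (2 * j) b a).Nonempty) ∨
          T ≤ 4 * k * (arc G (2 * k) b a).ncard := by
  classical
  have hne : Admissible c k D (⊥ : SimpleGraph V) :=
    { bip := fun u v h => h.elim
      deg := fun v => by simp [SimpleGraph.neighborSet]
      girth := fun j _ _ => by
        rw [Set.eq_empty_iff_forall_notMem]
        exact fun f hf => hf.2 0 }
  have : Nonempty {G : SimpleGraph V // Admissible c k D G} := ⟨⟨⊥, hne⟩⟩
  have : NeZero (2 * k) := ⟨by omega⟩
  -- The price of an edge is `T` cycles. `cyc` counts each `2k`-cycle `4k` times, once for every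
  -- base point and orientation, which is the source of the factor `4k` when an edge is added.
  obtain ⟨⟨G, hG⟩, hmax⟩ := Finite.exists_max
    (fun G : {G : SimpleGraph V // Admissible c k D G} =>
      ((T * G.1.edgeSet.ncard : ℕ) : ℤ) - ((cyc G.1 (2 * k)).ncard : ℤ))
  refine ⟨G, hG, ?_, ?_⟩
  · intro u w huw
    have h1 := hmax ⟨G.deleteEdges {s(u, w)}, hG.mono (SimpleGraph.deleteEdges_le _)⟩
    have h2 := ncard_cyc_deleteEdge_add_arc_le G huw (m := 2 * k)
    have h3 : (G.deleteEdges {s(u, w)}).edgeSet.ncard + 1 = G.edgeSet.ncard := by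
      rw [SimpleGraph.edgeSet_deleteEdges]
      exact Set.ncard_sdiff_singleton_add_one huw (Set.toFinite _)
    simp only [← h3, mul_add] at h1
    push_cast at h1
    linarith [(by exact_mod_cast h2 : ((cyc (G.deleteEdges {s(u, w)}) (2 * k)).ncard : ℤ) +
      (arc G (2 * k) u w).ncard ≤ (cyc G (2 * k)).ncard)]
  · intro a b hab ha hb
    by_contra! hcon
    obtain ⟨h1, h2, h3⟩ := hcon
    have hne : b ≠ a := fun h => hab (by rw [h])
    have hG' := hG.sup_edge hab.symm hb ha h2
    have h4 := hmax ⟨_, hG'⟩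
    have h5 : (G ⊔ SimpleGraph.edge b a).edgeSet.ncard = G.edgeSet.ncard + 1 := by
      rw [SimpleGraph.edgeSet_sup, SimpleGraph.edgeSet_edge_of_ne hne, Set.union_singleton,
        Set.ncard_insert_of_notMem _ (Set.toFinite _)]
      exact fun h => h1 (G.adj_symm h)
    have h6 := ncard_cyc_sup_edge_le G b a (m := 2 * k) (by omega)
    have h7 : 2 * (2 * k) * (arc G (2 * k) b a).ncard = 4 * k * (arc G (2 * k) b a).ncard := by
      ring
    simp only [h5, mul_add] at h4
    push_cast at h4
    zify at h6 h3 h7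
    linarith

/-- In an extremal graph a vertex of deficient degree sees few deficient vertices of the other
colour. -/
theorem ncard_le_of_arcs [Finite V] {G : SimpleGraph V} {k D T : ℕ} (hk : 2 ≤ k) (hD : 1 ≤ D)
    (hdeg : ∀ v, (G.neighborSet v).ncard ≤ D) (a : V) (B : Set V)
    (hB : ∀ b ∈ B, G.Adj a b ∨ (∃ j, 2 ≤ j ∧ j < k ∧ (arc G (2 * j) b a).Nonempty) ∨
          T ≤ 4 * k * (arc G (2 * k) b a).ncard) :
    T * B.ncard ≤ T * (k * D ^ (2 * k - 2)) + 4 * k * D ^ (2 * k - 1) := by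
  classical
  have := Fintype.ofFinite V
  have : NeZero (2 * k) := ⟨by omega⟩
  set B3 : Set V := {b | T ≤ 4 * k * (arc G (2 * k) b a).ncard} with hB3
  have harcs : ∀ j, 1 ≤ j →
      {f : ZMod (2 * j) → V | f 0 = a ∧ ∀ i, i ≠ -1 → G.Adj (f i) (f (i + 1))}.ncard ≤
        D ^ (2 * j - 1) := by
    intro j hj
    obtain ⟨m, hm⟩ : ∃ m, 2 * j = m + 1 := ⟨2 * j - 1, by omega⟩
    rw [hm]
    exact ncard_arcs_from_le G hdeg a m
  -- Double counting by the last vertex: every `b` in `B3` ends at least `T / (4k)` of the at most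
  -- `D^(2k-1)` arcs that start at `a`.
  have h3 : T * B3.ncard ≤ 4 * k * D ^ (2 * k - 1) := by
    rw [Set.ncard_eq_toFinset_card' B3, mul_comm, ← smul_eq_mul, ← Finset.sum_const]
    calc _ ≤ ∑ b ∈ B3.toFinset, 4 * k * (arc G (2 * k) b a).ncard :=
          Finset.sum_le_sum fun b hb => by simpa [hB3] using hb
      _ = 4 * k * ∑ b ∈ B3.toFinset, (arc G (2 * k) b a).ncard := by rw [Finset.mul_sum]
      _ ≤ _ := by
        gcongr
        refine le_trans ?_ (harcs k (by omega))
        rw [Set.ncard_eq_toFinset_card']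
        refine le_trans (Finset.sum_le_sum fun b _ => ?_)
          ((Finset.sum_card_fiberwise_eq_card_filter _ B3.toFinset
            (fun f : ZMod (2 * k) → V => f (-1))).trans_le (Finset.card_filter_le _ _))
        rw [← Set.ncard_coe_finset]
        refine Set.ncard_le_ncard ?_ (Set.toFinite _)
        rintro f ⟨-, h1, h2, h3⟩
        simp only [Finset.coe_filter, Set.mem_toFinset, Set.mem_ofPred_eq]
        exact ⟨⟨h2, h3⟩, h1⟩
  have hsub : B ⊆ (G.neighborSet a ∪ ⋃ j ∈ Finset.Ico 2 k,
      {b | (arc G (2 * j) b a).Nonempty}) ∪ B3 := by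
    intro b hb
    rcases hB b hb with h | ⟨j, h1, h2, h⟩ | h
    · exact Or.inl (Or.inl h)
    · exact Or.inl (Or.inr (by
        simp only [Set.mem_iUnion]; exact ⟨j, Finset.mem_Ico.2 ⟨h1, h2⟩, h⟩))
    · exact Or.inr h
  have hpow : ∀ i, i ≤ 2 * k - 2 → D ^ i ≤ D ^ (2 * k - 2) := fun i hi =>
    Nat.pow_le_pow_right hD hi
  have hj : ∀ j ∈ Finset.Ico 2 k, {b | (arc G (2 * j) b a).Nonempty}.ncard ≤ D ^ (2 * k - 2) := by
    intro j hj
    rw [Finset.mem_Ico] at hj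
    have : NeZero (2 * j) := ⟨by omega⟩
    refine le_trans ?_ ((harcs j (by omega)).trans (hpow _ (by omega)))
    refine le_trans (Set.ncard_le_ncard ?_ (Set.toFinite _))
      (Set.ncard_image_le (f := fun f : ZMod (2 * j) → V => f (-1)) (Set.toFinite _))
    rintro b ⟨f, -, h1, h2, h3⟩
    exact ⟨f, ⟨h2, h3⟩, h1⟩
  have h12 : (G.neighborSet a ∪ ⋃ j ∈ Finset.Ico 2 k,
      {b | (arc G (2 * j) b a).Nonempty}).ncard ≤ k * D ^ (2 * k - 2) := by
    refine (Set.ncard_union_le _ _).trans ?_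
    have e1 := (hdeg a).trans (by simpa using hpow 1 (by omega))
    have e2 := (Finset.set_ncard_biUnion_le (Finset.Ico 2 k)
      (fun j => {b | (arc G (2 * j) b a).Nonempty})).trans (Finset.sum_le_sum hj)
    rw [Finset.sum_const, Nat.card_Ico, smul_eq_mul] at e2
    obtain ⟨l, rfl⟩ : ∃ l, k = l + 2 := ⟨k - 2, by omega⟩
    simp only [Nat.add_sub_cancel] at e2
    nlinarith
  have := (Set.ncard_le_ncard hsub (Set.toFinite _)).trans (Set.ncard_union_le _ _)
  calc T * B.ncard ≤ T * (k * D ^ (2 * k - 2) + B3.ncard) := by gcongr; omega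
    _ ≤ _ := by rw [mul_add]; omega

/-- Since `320 = 20 · 16`, this comes down to `130k ≤ 20^(2k-2)`. -/
theorem numeric_bound {k T N : ℕ} (hk : 2 ≤ k) (hN : (320 * T) ^ (2 * k - 2) ≤ N) :
    130 * k * (16 * T) ^ (2 * k - 2) ≤ N := by
  have h1 : ∀ l : ℕ, 130 * (l + 2) ≤ 20 ^ (2 * l + 2) := by
    intro l
    induction l with
    | zero => norm_num
    | succ l ih =>
      rw [show 2 * (l + 1) + 2 = (2 * l + 2) + 2 by ring, pow_add]
      omega
  obtain ⟨l, rfl⟩ : ∃ l, k = l + 2 := ⟨k - 2, by omega⟩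
  rw [show 2 * (l + 2) - 2 = 2 * l + 2 by omega] at hN ⊢
  calc _ ≤ 20 ^ (2 * l + 2) * (16 * T) ^ (2 * l + 2) := by gcongr; exact h1 l
    _ = (320 * T) ^ (2 * l + 2) := by rw [← mul_pow]; ring_nf
    _ ≤ N := hN

/-- Dense bipartite graphs without cycles of length less than `2k` in which every edge lies on few
`2k`-cycles. -/
theorem exists_dense [Finite V] (c : V → Bool) {k T N : ℕ} (hk : 2 ≤ k) (hT : 1 ≤ T)
    (hA : N ≤ {v | c v = true}.ncard) (hB : N ≤ {v | c v = false}.ncard)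
    (hN : (320 * T) ^ (2 * k - 2) ≤ N) :
    ∃ G, Admissible c k (16 * T) G ∧ (∀ u w, G.Adj u w → (arc G (2 * k) u w).ncard ≤ T) ∧
      8 * N * T ≤ G.edgeSet.ncard := by
  obtain ⟨G, hG, hT', hmax⟩ := exists_extremal c hk (16 * T) T
  refine ⟨G, hG, hT', ?_⟩
  -- If the `true` class has full degree throughout, it alone gives `16NT` edges. Otherwise one
  -- deficient vertex in it forces at least half of `N` vertices of the other class to have full
  -- degree, which gives `8NT`.
  by_cases hfull : ∀ a, c a = true → 16 * T ≤ (G.neighborSet a).ncard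
  · have := mul_ncard_le_ncard_edgeSet hG.bip (F := {v | c v = true}) (s := true)
      (fun v hv => hv) (D := 16 * T) (fun v hv => hfull v hv)
    nlinarith
  push Not at hfull
  obtain ⟨a, ha, hda⟩ := hfull
  set B : Set V := {b | c b = false ∧ (G.neighborSet b).ncard < 16 * T} with hBdef
  set F : Set V := {b | c b = false ∧ 16 * T ≤ (G.neighborSet b).ncard} with hFdef
  have h1 := ncard_le_of_arcs (T := T) hk (by omega) hG.deg a B
    (fun b hb => hmax a b (by simp [ha, hb.1]) hda hb.2)
  have h2 := numeric_bound hk hN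
  have h3 : 2 * B.ncard ≤ N := by
    have e : (16 * T) ^ (2 * k - 1) = 16 * T * (16 * T) ^ (2 * k - 2) := by
      rw [← pow_succ']; congr 1; omega
    rw [e] at h1
    -- With `D = 16T` the second term is `4kD^(2k-1) = 64kT · D^(2k-2)`, and `65 = 64 + 1`.
    have : T * B.ncard ≤ T * (65 * k * (16 * T) ^ (2 * k - 2)) := by
      refine h1.trans (le_of_eq ?_)
      ring
    have := Nat.le_of_mul_le_mul_left this (by omega)
    nlinarith
  have h4 : {v | c v = false}.ncard ≤ B.ncard + F.ncard := by
    refine le_trans (Set.ncard_le_ncard ?_ (Set.toFinite _)) (Set.ncard_union_le _ _)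
    intro b hb
    rcases lt_or_ge (G.neighborSet b).ncard (16 * T) with h | h
    · exact Or.inl ⟨hb, h⟩
    · exact Or.inr ⟨hb, h⟩
  have h5 := mul_ncard_le_ncard_edgeSet hG.bip (F := F) (s := false)
      (fun v hv => hv.1) (D := 16 * T) (fun v hv => hv.2)
  nlinarith

end SumNCG

/-! ### Shortest paths and branches in bipartite graphs without short cycles. -/

namespace SumNCG

variable {V : Type}

/-- The values `P 0, …, P l` form a shortest path that starts at `u`. -/
structure IsGeodesic (G : SimpleGraph V) (u : V) (l : ℕ) (P : ℕ → V) : Prop where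
  start : P 0 = u
  adj : ∀ i, i < l → G.Adj (P i) (P (i + 1))
  dist_end : G.dist u (P l) = l

theorem dist_le_dist_add_of_steps {G : SimpleGraph V} (hG : G.Connected) {P : ℕ → V} {l : ℕ}
    (hP : ∀ i, i < l → G.Adj (P i) (P (i + 1))) (u : V) {i j : ℕ} (h : i + j ≤ l) :
    G.dist u (P (i + j)) ≤ G.dist u (P i) + j := by
  induction j with
  | zero => simp
  | succ j ih =>
    have h1 := hG.dist_triangle (u := u) (v := P (i + j)) (w := P (i + j + 1))
    rw [SimpleGraph.dist_eq_one_iff_adj.2 (hP (i + j) (by omega))] at h1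
    have := ih (by omega)
    rw [← add_assoc]
    omega

theorem IsGeodesic.dist_eq {G : SimpleGraph V} (hG : G.Connected) {u : V} {l : ℕ} {P : ℕ → V}
    (hP : IsGeodesic G u l P) {i : ℕ} (hi : i ≤ l) : G.dist u (P i) = i := by
  have h1 := dist_le_dist_add_of_steps hG hP.adj u (i := 0) (j := i) (by omega)
  have h2 := dist_le_dist_add_of_steps hG hP.adj u (i := i) (j := l - i) (by omega)
  rw [hP.start, SimpleGraph.dist_self, zero_add] at h1
  rw [show i + (l - i) = l by omega, hP.dist_end] at h2
  omega

theorem exists_pred {G : SimpleGraph V} (hG : G.Connected) {u v : V} {l : ℕ}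
    (h : G.dist u v = l + 1) : ∃ v', G.Adj v' v ∧ G.dist u v' = l := by
  obtain ⟨p, hp⟩ := hG.exists_walk_length_eq_dist v u
  rw [SimpleGraph.dist_comm, h] at hp
  cases p with
  | nil => simp at hp
  | @cons _ v' _ hadj q =>
    refine ⟨v', hadj.symm, ?_⟩
    have h1 := SimpleGraph.dist_le q
    rw [SimpleGraph.dist_comm] at h1
    have h2 := hG.dist_triangle (u := u) (v := v') (w := v)
    rw [SimpleGraph.dist_eq_one_iff_adj.2 hadj.symm] at h2
    simp at hp
    omega

theorem IsGeodesic.extend {G : SimpleGraph V} {u v : V} {l : ℕ} {P : ℕ → V}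
    (hP : IsGeodesic G u l P) (hv : G.Adj (P l) v) (hd : G.dist u v = l + 1) :
    IsGeodesic G u (l + 1) (Function.update P (l + 1) v) where
  start := by rw [Function.update_of_ne (by omega)]; exact hP.start
  adj i hi := by
    rw [Function.update_of_ne (by omega : i ≠ l + 1)]
    by_cases h : i = l
    · subst h; simpa using hv
    · rw [Function.update_of_ne (by omega)]
      exact hP.adj i (by omega)
  dist_end := by simpa using hd

theorem exists_geodesic {G : SimpleGraph V} (hG : G.Connected) (u : V) :
    ∀ (l : ℕ) (v : V), G.dist u v = l → ∃ P, IsGeodesic G u l P ∧ P l = v := by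
  intro l
  induction l with
  | zero =>
    intro v hv
    exact ⟨fun _ => v, ⟨((hG.dist_eq_zero_iff).1 hv).symm, by simp, hv⟩, rfl⟩
  | succ l ih =>
    intro v hv
    obtain ⟨v', hadj, hd⟩ := exists_pred hG hv
    obtain ⟨P, hP, rfl⟩ := ih v' hd
    exact ⟨_, hP.extend hadj hv, by simp⟩

theorem cycle_of_geodesics {G : SimpleGraph V} (hG : G.Connected) {u : V} {l : ℕ}
    {P P' : ℕ → V} (hP : IsGeodesic G u l P) (hP' : IsGeodesic G u l P') {i m : ℕ} (hm : 2 ≤ m)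
    (hl : i + m ≤ l) (hi : P i = P' i) (hj : P (i + m) = P' (i + m))
    (hne : ∀ t, 0 < t → t < m → P (i + t) ≠ P' (i + t)) :
    ∃ f ∈ cyc G (2 * m), f (-1) = P i ∧ f 0 = P (i + 1) ∧ f 1 = P (i + 2) := by
  have : NeZero (2 * m) := ⟨by omega⟩
  have hone : (1 : ZMod (2 * m)).val = 1 := ZMod.val_one'' (by omega)
  have hneg : (-1 : ZMod (2 * m)).val = 2 * m - 1 := by
    obtain ⟨r, hr⟩ : ∃ r, 2 * m = r + 1 := ⟨2 * m - 1, by omega⟩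
    rw [hr]; exact ZMod.val_neg_one r
  -- Out along `P` from `P (i + 1)` to the meeting point `P (i + m)`, then back along `P'` to `P' i
  -- = P i`. Equal vertices would have equal distance from `u`, so the two halves can only meet at
  -- equal indices.
  let g : ℕ → V := fun n => if n < m then P (i + n + 1) else P' (i + (2 * m - 1 - n))
  have hg1 : ∀ n, n < m → g n = P (i + n + 1) := fun n hn => if_pos hn
  have hg2 : ∀ n, m ≤ n → g n = P' (i + (2 * m - 1 - n)) := fun n hn => if_neg (by omega)
  refine ⟨fun x => g x.val, ⟨?_, ?_⟩, ?_, ?_, ?_⟩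
  · intro x y hxy
    apply ZMod.val_injective
    have hx := x.val_lt
    have hy := y.val_lt
    have key : ∀ a b, a < m → m ≤ b → b < 2 * m → g a ≠ g b := by
      intro a b ha hb hb' hab
      rw [hg1 a ha, hg2 b hb] at hab
      have h := congrArg (G.dist u) hab
      rw [hP.dist_eq hG (by omega), hP'.dist_eq hG (by omega)] at h
      apply hne (a + 1) (by omega) (by omega)
      rw [show i + (a + 1) = i + a + 1 by omega, hab]
      congr 1; omega
    simp only at hxy
    rcases lt_or_ge x.val m with h1 | h1 <;> rcases lt_or_ge y.val m with h2 | h2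
    · rw [hg1 _ h1, hg1 _ h2] at hxy
      have h := congrArg (G.dist u) hxy
      rw [hP.dist_eq hG (by omega), hP.dist_eq hG (by omega)] at h
      omega
    · exact absurd hxy (key _ _ h1 h2 hy)
    · exact absurd hxy.symm (key _ _ h2 h1 hx)
    · rw [hg2 _ h1, hg2 _ h2] at hxy
      have h := congrArg (G.dist u) hxy
      rw [hP'.dist_eq hG (by omega), hP'.dist_eq hG (by omega)] at h
      omega
  · intro x
    have hx := x.val_lt
    simp only
    rw [ZMod.val_add, hone]
    by_cases h : x.val + 1 < 2 * m
    · rw [Nat.mod_eq_of_lt h]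
      rcases lt_trichotomy (x.val + 1) m with h1 | h1 | h1
      · rw [hg1 _ (by omega), hg1 _ h1]
        exact hP.adj _ (by omega)
      · rw [hg1 _ (by omega), hg2 _ (by omega), show i + x.val + 1 = i + m by omega, hj,
          show i + m = i + (2 * m - 1 - (x.val + 1)) + 1 by omega]
        exact (hP'.adj _ (by omega)).symm
      · rw [hg2 _ (by omega), hg2 _ (by omega),
          show i + (2 * m - 1 - x.val) = i + (2 * m - 1 - (x.val + 1)) + 1 by omega]
        exact (hP'.adj _ (by omega)).symm
    · rw [show x.val + 1 = 2 * m by omega, Nat.mod_self, hg1 0 (by omega), hg2 _ (by omega),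
        show i + (2 * m - 1 - x.val) = i by omega, ← hi]
      exact hP.adj i (by omega)
  · simp only [hneg]
    rw [hg2 _ (by omega), show i + (2 * m - 1 - (2 * m - 1)) = i by omega, hi]
  · simp only [ZMod.val_zero]
    rw [hg1 _ (by omega)]
  · simp only [hone]
    rw [hg1 _ (by omega)]

/-- If there are no cycles of length less than `2k`, then two different shortest paths of length at
most `k` with the same ends have length `k` and form a `2k`-cycle. -/
theorem two_geodesics {G : SimpleGraph V} (hG : G.Connected) {k : ℕ}
    (hgirth : ∀ j, 2 ≤ j → j < k → cyc G (2 * j) = ∅) {u : V} {l : ℕ}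
    {P P' : ℕ → V} (hP : IsGeodesic G u l P) (hP' : IsGeodesic G u l P') (hl : l ≤ k)
    (hend : P l = P' l) {t : ℕ} (ht : t ≤ l) (hne : P t ≠ P' t) :
    l = k ∧ ∃ f ∈ cyc G (2 * k), f (-1) = u ∧ f 0 = P 1 ∧ f 1 = P 2 := by
  classical
  have h0 : P 0 = P' 0 := hP.start.trans hP'.start.symm
  have hex : ∃ s, P (t + s) = P' (t + s) := ⟨l - t, by rw [show t + (l - t) = l by omega, hend]⟩
  have hex' : ∃ s, P (t - s) = P' (t - s) := ⟨t, by simpa using h0⟩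
  -- The nearest agreements after and before `t` bound a cycle of length `2(s' + s)`. The girth
  -- forces `s' + s ≥ k`, while `s' + s ≤ l ≤ k`; so the paths separate at `u` itself and meet only
  -- at the end.
  set s := Nat.find hex with hs
  set s' := Nat.find hex' with hs'
  have h1 := Nat.find_spec hex
  have h1' := Nat.find_spec hex'
  have h2 : s ≤ l - t := Nat.find_min' hex (by rw [show t + (l - t) = l by omega, hend])
  have h2' : s' ≤ t := Nat.find_min' hex' (by simpa using h0)
  rw [← hs] at h1
  rw [← hs'] at h1'
  have hs0 : s ≠ 0 := fun h => hne (by simpa [h] using h1)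
  have hs0' : s' ≠ 0 := fun h => hne (by simpa [h] using h1')
  have hcyc := cycle_of_geodesics hG hP hP' (i := t - s') (m := s' + s) (by omega) (by omega) h1'
    (by rw [show t - s' + (s' + s) = t + s by omega, h1]) (by
      intro r hr hr'
      rcases lt_or_ge r s' with h | h
      · have := Nat.find_min hex' (m := s' - r) (by omega)
        rwa [show t - (s' - r) = t - s' + r by omega] at this
      · have := Nat.find_min hex (m := r - s') (by omega)
        rwa [show t + (r - s') = t - s' + r by omega] at this)
  have hk : ¬ s' + s < k := fun h => by
    obtain ⟨f, hf, -⟩ := hcyc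
    rw [hgirth _ (by omega) h] at hf
    exact hf
  have e1 : s' + s = k := by omega
  have e2 : t - s' = 0 := by omega
  rw [e1, e2, hP.start] at hcyc
  exact ⟨by omega, hcyc⟩

/-- `y` is a further neighbour of `w` such that the path `u, w, y` lies on no `2k`-cycle. -/
structure IsClean (G : SimpleGraph V) (k : ℕ) (u w y : V) : Prop where
  adj : G.Adj w y
  ne : y ≠ u
  not_cyc : ∀ f ∈ cyc G (2 * k), f (-1) = u → f 0 = w → f 1 ≠ y

/-- The vertices in the `k`-neighbourhood of `u` that have a shortest path to `u` through `y`, where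
`y` has distance two from `u`. -/
def branch (G : SimpleGraph V) (k : ℕ) (u y : V) : Set V :=
  {v | G.dist u v = G.dist y v + 2 ∧ G.dist u v ≤ k}

/-- Connected graphs that are bipartite and have no cycles of length less than `2k`. -/
structure IsThin (G : SimpleGraph V) (k : ℕ) : Prop where
  connected : G.Connected
  bip : ∃ c : V → Bool, ∀ u v, G.Adj u v → c u ≠ c v
  girth : ∀ j, 2 ≤ j → j < k → cyc G (2 * j) = ∅

variable {G : SimpleGraph V} {k : ℕ}

theorem IsThin.even_dist_iff (h : IsThin G k) :
    ∃ c : V → Bool, (∀ u v, G.Adj u v → c u ≠ c v) ∧ ∀ u v, Even (G.dist u v) ↔ c u = c v := by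
  obtain ⟨c, hc⟩ := h.bip
  refine ⟨c, hc, fun u v => ?_⟩
  obtain ⟨p, hp⟩ := h.connected.exists_walk_length_eq_dist u v
  rw [← hp, SimpleGraph.Coloring.even_length_iff_congr (SimpleGraph.Coloring.mk c (hc _ _)) p]
  change ((c u = true) ↔ (c v = true)) ↔ _
  cases c u <;> cases c v <;> simp

/-- Bipartiteness excludes edges between vertices at equal distance from `u`. -/
theorem IsThin.dist_step (h : IsThin G k) (u : V) {v v' : V} (hv : G.Adj v v') :
    G.dist u v' = G.dist u v + 1 ∨ G.dist u v = G.dist u v' + 1 := by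
  obtain ⟨c, hc, hp⟩ := h.even_dist_iff
  have h1 := h.connected.dist_triangle (u := u) (v := v) (w := v')
  have h2 := h.connected.dist_triangle (u := u) (v := v') (w := v)
  rw [SimpleGraph.dist_eq_one_iff_adj.2 hv] at h1
  rw [SimpleGraph.dist_eq_one_iff_adj.2 hv.symm] at h2
  have : G.dist u v ≠ G.dist u v' := by
    intro he
    have e1 := hp u v
    have e2 := hp u v'
    rw [he] at e1
    have e3 := hc _ _ hv
    have e4 := e1.symm.trans e2
    revert e3 e4
    cases c u <;> cases c v <;> cases c v' <;> simp
  omega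

theorem IsThin.dist_eq_two (h : IsThin G k) {u w y : V} (hw : G.Adj u w) (hy : IsClean G k u w y) :
    G.dist u y = 2 := by
  have h1 := h.dist_step u hy.adj
  rw [SimpleGraph.dist_eq_one_iff_adj.2 hw] at h1
  have := (h.connected.pos_dist_of_ne hy.ne.symm)
  omega

theorem IsThin.mem_branch_self (h : IsThin G k) (hk : 2 ≤ k) {u w y : V} (hw : G.Adj u w)
    (hy : IsClean G k u w y) : y ∈ branch G k u y := by
  have := h.dist_eq_two hw hy
  simp [branch, this, hk]

/-- Two predecessors would give two shortest paths of length less than `k`, contrary to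
`two_geodesics`. -/
theorem IsThin.pred_unique (h : IsThin G k) {u v p q : V} (hv : G.dist u v < k)
    (hp : G.Adj p v) (hq : G.Adj q v) (hp' : G.dist u p + 1 = G.dist u v)
    (hq' : G.dist u q + 1 = G.dist u v) : p = q := by
  by_contra hne
  obtain ⟨l, hl⟩ : ∃ l, G.dist u p = l := ⟨_, rfl⟩
  obtain ⟨P, hP, hPp⟩ := exists_geodesic h.connected u l p hl
  obtain ⟨Q, hQ, hQq⟩ := exists_geodesic h.connected u l q (by omega)
  have := two_geodesics h.connected h.girth (hP.extend (v := v) (by rwa [hPp]) (by omega))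
    (hQ.extend (v := v) (by rwa [hQq]) (by omega)) (by omega) (by simp) (t := l) (by omega)
    (by simpa [hPp, hQq] using hne)
  omega

/-- A shortest path to `v` through `v'` must coincide with the one through `w` and `y`: otherwise
both have length `k` and form a `2k`-cycle through `u, w, y`, and `y` is not clean. This covers
distance `k`, where predecessors need not be unique in general. -/
theorem IsThin.pred_mem_branch (h : IsThin G k) {u w y : V} (hw : G.Adj u w)
    (hy : IsClean G k u w y) {v v' : V} (hv : v ∈ branch G k u y) (hv' : G.Adj v' v)
    (hd : G.dist u v' + 1 = G.dist u v) : v' = w ∧ v = y ∨ v' ∈ branch G k u y := by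
  obtain ⟨hv1, hv2⟩ := hv
  obtain ⟨Q, hQ, hQv⟩ := exists_geodesic h.connected y _ v rfl
  obtain ⟨R, hR, hRv⟩ := exists_geodesic h.connected u _ v' rfl
  generalize hl : G.dist y v = l at *
  have hR' := hR.extend (v := v) (by rw [hRv]; exact hv') (by omega)
  rw [show G.dist u v' = l + 1 by omega] at hR' hR hRv
  let P : ℕ → V := fun i => match i with
    | 0 => u
    | 1 => w
    | i + 2 => Q i
  have hP : IsGeodesic G u (l + 2) P := by
    refine ⟨rfl, ?_, ?_⟩
    · intro i hi
      match i with
      | 0 => exact hw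
      | 1 => change G.Adj w (Q 0); rw [hQ.start]; exact hy.adj
      | i + 2 => exact hQ.adj i (by omega)
    · change G.dist u (Q l) = _
      rw [hQv, hv1]
  have heq : ∀ t ≤ l + 2, P t = Function.update R (l + 1 + 1) v t := by
    by_contra! hcon
    obtain ⟨t, ht, hne⟩ := hcon
    obtain ⟨-, f, hf, h1, h2, h3⟩ := two_geodesics h.connected h.girth hP hR' (by omega)
      (by simpa [P] using hQv) ht hne
    exact hy.not_cyc f hf h1 h2 (h3.trans hQ.start)
  have h1 := heq (l + 1) (by omega)
  rw [Function.update_of_ne (by omega), hRv] at h1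
  rcases l with _ | l
  · left
    exact ⟨h1.symm, by rw [← hQv, hQ.start]⟩
  · right
    change Q l = v' at h1
    have := hQ.dist_eq h.connected (i := l) (by omega)
    rw [h1] at this
    exact ⟨by omega, by omega⟩

/-- Inside the `k`-neighbourhood of `u`, a branch is attached to the rest by one edge only. -/
theorem IsThin.adj_branch (h : IsThin G k) {u w y : V} (hw : G.Adj u w)
    (hy : IsClean G k u w y) {v v' : V} (hv : v ∈ branch G k u y) (hv' : G.Adj v v')
    (hd : G.dist u v' ≤ k) : v = y ∧ v' = w ∨ v' ∈ branch G k u y := by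
  rcases h.dist_step u hv' with h1 | h1
  · right
    have h2 := h.connected.dist_triangle (u := y) (v := v) (w := v')
    have h3 := h.connected.dist_triangle (u := u) (v := y) (w := v')
    rw [h.dist_eq_two hw hy] at h3
    rw [SimpleGraph.dist_eq_one_iff_adj.2 hv'] at h2
    have := hv.1
    exact ⟨by omega, hd⟩
  · rcases h.pred_mem_branch hw hy hv hv'.symm h1.symm with h2 | h2
    · exact Or.inl h2.symm
    · exact Or.inr h2

/-- Descend towards `u` from a common vertex: its predecessor stays in both branches until one of
the roots is reached, and there the predecessor is a neighbour of `u`, which lies in no branch. -/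
theorem IsThin.branch_disjoint (h : IsThin G k) {u w y w' y' : V} (hw : G.Adj u w)
    (hy : IsClean G k u w y) (hw' : G.Adj u w') (hy' : IsClean G k u w' y') {v : V}
    (hv : v ∈ branch G k u y) (hv' : v ∈ branch G k u y') : w = w' ∧ y = y' := by
  induction hl : G.dist u v using Nat.strong_induction_on generalizing v with
  | _ l ih =>
    have hne : ∀ {w y : V}, G.Adj u w → ∀ y, w ∉ branch G k u y := by
      intro w _ hw y hmem
      have := hmem.1
      rw [SimpleGraph.dist_eq_one_iff_adj.2 hw] at this
      omega
    by_cases hvy : v = y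
    · subst hvy
      have := h.dist_eq_two hw hy
      rcases h.pred_mem_branch hw' hy' hv' hy.adj
        (by rw [this, SimpleGraph.dist_eq_one_iff_adj.2 hw]) with h1 | h1
      · exact h1
      · exact absurd h1 (hne (y := v) hw _)
    · have h0 := hv.1
      obtain ⟨p, hp, hpd⟩ := exists_pred h.connected (u := u) (v := v) (l := G.dist y v + 1) h0
      have h1 := h.pred_mem_branch hw hy hv hp (by omega)
      have h2 := h.pred_mem_branch hw' hy' hv' hp (by omega)
      rcases h1 with ⟨-, h1⟩ | h1
      · exact absurd h1 hvy
      rcases h2 with ⟨rfl, -⟩ | h2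
      · exact absurd h1 (hne (y := v) hw' _)
      · exact ih _ (by omega) h1 h2 rfl

/-- Below distance `k` predecessors are unique, so of two neighbours in `Z` at least one is farther
from `u`. The branch can thus be followed up to the rim of the view. -/
theorem IsThin.exists_mem_branch_dist_eq (h : IsThin G k) {Z : Set V}
    (hZ : ∀ v ∈ Z, ∃ p q, p ≠ q ∧ p ∈ Z ∧ q ∈ Z ∧ G.Adj v p ∧ G.Adj v q) (hk : 2 ≤ k)
    {u w y : V} (hw : G.Adj u w) (hy : IsClean G k u w y) (hyZ : y ∈ Z) :
    ∃ v ∈ branch G k u y, G.dist u v = k := by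
  have : ∀ l, 2 ≤ l → l ≤ k → ∃ v ∈ branch G k u y, v ∈ Z ∧ G.dist u v = l := by
    intro l hl
    induction l, hl using Nat.le_induction with
    | base => exact fun _ => ⟨y, h.mem_branch_self hk hw hy, hyZ, h.dist_eq_two hw hy⟩
    | succ l hl ih =>
      intro hlk
      obtain ⟨v, hv, hvZ, hd⟩ := ih (by omega)
      obtain ⟨p, q, hpq, hpZ, hqZ, hp, hq⟩ := hZ v hvZ
      have : ∃ r ∈ Z, G.Adj v r ∧ G.dist u r = l + 1 := by
        rcases h.dist_step u hp with h1 | h1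
        · exact ⟨p, hpZ, hp, by omega⟩
        rcases h.dist_step u hq with h2 | h2
        · exact ⟨q, hqZ, hq, by omega⟩
        · exact absurd (h.pred_unique (by omega) hp.symm hq.symm h1.symm h2.symm) hpq
      obtain ⟨r, hrZ, hr, hrd⟩ := this
      refine ⟨r, ?_, hrZ, hrd⟩
      rcases h.adj_branch hw hy hv hr (by omega) with ⟨-, rfl⟩ | h1
      · rw [SimpleGraph.dist_eq_one_iff_adj.2 hw] at hrd
        omega
      · exact h1
  obtain ⟨v, h1, -, h2⟩ := this k hk le_rfl
  exact ⟨v, h1, h2⟩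

end SumNCG

/-! ### Compatible networks that `u` must reckon with. -/

namespace SumNCG

variable {V : Type}

theorem network_adj_of_asymm {σ : Profile V} (h : ∀ u v, v ∈ σ u → u ∉ σ v) {u v : V} :
    (network σ).Adj u v ↔ v ∈ σ u ∨ u ∈ σ v := by
  rw [network, SimpleGraph.fromRel_adj]
  refine ⟨fun h => h.2, fun h' => ⟨?_, h'⟩⟩
  rintro rfl
  rcases h' with h' | h' <;> exact h _ _ h' h'

theorem network_adj_of_legal {σ : Profile V} (h : σ.IsLegal) {u v : V} :
    (network σ).Adj u v ↔ v ∈ σ u ∨ u ∈ σ v := by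
  rw [network, SimpleGraph.fromRel_adj]
  refine ⟨fun h => h.2, fun h' => ⟨?_, h'⟩⟩
  rintro rfl
  rcases h' with h' | h' <;> exact h _ h'

theorem mem_kNeighborhood_iff {G : SimpleGraph V} (hG : G.Connected) {k : ℕ} {u v : V} :
    v ∈ kNeighborhood G k u ↔ G.dist u v ≤ k := by
  rw [kNeighborhood, Set.mem_ofPred_eq, ← (hG u v).coe_dist_eq_edist, Nat.cast_le]

/-- A function that changes by at most one along edges bounds distances from below. -/
theorem le_edist_of_step {G : SimpleGraph V} {h : V → ℕ}
    (hh : ∀ a b, G.Adj a b → h b ≤ h a + 1) {s : V} (hs : h s = 0) (z : V) :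
    (h z : ℕ∞) ≤ G.edist s z := by
  have key : ∀ {a b : V} (p : G.Walk a b), h b ≤ h a + p.length := by
    intro a b p
    induction p with
    | nil => simp
    | cons hadj p ih =>
      have := hh _ _ hadj
      rw [SimpleGraph.Walk.length_cons]
      omega
  rw [SimpleGraph.edist_eq_sInf]
  refine le_sInf ?_
  rintro _ ⟨p, rfl⟩
  have := key p
  rw [hs, zero_add] at this
  exact Nat.cast_le.2 this

section Realization

variable (k : ℕ) (σ : Profile V) (u x : V) (N : ℕ)

/-- The players that `u` sees, and `N` further ones. -/
abbrev Extension (k : ℕ) (σ : Profile V) (u : V) (N : ℕ) : Type :=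
  {v // v ∈ kNeighborhood (network σ) k u} ⊕ Fin N

/-- Who buys an edge to whom if every further player buys one edge, to `x`. -/
def extensionRel : Extension k σ u N → Extension k σ u N → Prop
  | Sum.inl a, Sum.inl b => b.1 ∈ σ a.1
  | Sum.inr _, Sum.inl b => b.1 = x
  | _, Sum.inr _ => False

open Classical in
/-- The players that `u` sees play as in `σ`, and every further player buys an edge to `x`. -/
noncomputable def extension [Finite V] : Profile (Extension k σ u N) := fun a =>
  haveI := Fintype.ofFinite (Extension k σ u N)
  Finset.univ.filter fun b => extensionRel k σ u x N a b

theorem self_mem_kNeighborhood : u ∈ kNeighborhood (network σ) k u := by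
  simp [kNeighborhood]

open Classical in
/-- The position of the visible players in the extension. -/
noncomputable def toExtension (v : V) : Extension k σ u N :=
  if h : v ∈ kNeighborhood (network σ) k u then Sum.inl ⟨v, h⟩
  else Sum.inl ⟨u, self_mem_kNeighborhood k σ u⟩

variable {k σ u x N}

theorem toExtension_of_mem {v : V} (h : v ∈ kNeighborhood (network σ) k u) :
    toExtension k σ u N v = Sum.inl ⟨v, h⟩ := dif_pos h

theorem mem_extension [Finite V] {a b : Extension k σ u N} :
    b ∈ extension k σ u x N a ↔ extensionRel k σ u x N a b := by
  simp [extension]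

theorem extension_isLegal [Finite V] (hσ : σ.IsLegal) : (extension k σ u x N).IsLegal := by
  rintro (a | i) h <;> rw [mem_extension] at h
  · exact hσ _ h
  · exact h

theorem edist_extension_le [Finite V] (hσ : σ.IsLegal) (hG : (network σ).Connected) (l : ℕ) :
    ∀ v (hv : v ∈ kNeighborhood (network σ) k u), (network σ).dist u v = l →
      (network (extension k σ u x N)).edist (toExtension k σ u N u) (Sum.inl ⟨v, hv⟩) ≤ l := by
  rw [toExtension_of_mem (self_mem_kNeighborhood k σ u)]
  induction l with
  | zero =>
    intro v hv hd
    obtain rfl := (hG.dist_eq_zero_iff).1 hd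
    simp
  | succ l ih =>
    intro v hv hd
    obtain ⟨p, hp, hpd⟩ := exists_pred hG hd
    have hpk : p ∈ kNeighborhood (network σ) k u := by
      rw [mem_kNeighborhood_iff hG] at hv ⊢
      omega
    refine (SimpleGraph.edist_triangle (v := Sum.inl ⟨p, hpk⟩)).trans ?_
    push_cast
    gcongr
    · exact ih p hpk hpd
    · refine (SimpleGraph.edist_eq_one_iff_adj.2 ?_).le
      rw [network_adj_of_legal (extension_isLegal hσ), mem_extension, mem_extension]
      exact (network_adj_of_legal hσ).1 hp

theorem edist_extension_leaf_le [Finite V] (hσ : σ.IsLegal) (hG : (network σ).Connected)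
    (hx : (network σ).dist u x = k) (i : Fin N) :
    (network (extension k σ u x N)).edist (toExtension k σ u N u) (Sum.inr i) ≤ (k + 1 : ℕ) := by
  have hxk : x ∈ kNeighborhood (network σ) k u := (mem_kNeighborhood_iff hG).2 hx.le
  refine (SimpleGraph.edist_triangle (v := Sum.inl ⟨x, hxk⟩)).trans ?_
  push_cast
  gcongr
  · exact edist_extension_le hσ hG k x hxk hx
  · refine (SimpleGraph.edist_eq_one_iff_adj.2 ?_).le
    rw [network_adj_of_legal (extension_isLegal hσ), mem_extension, mem_extension]
    exact Or.inr rfl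

/-- The vertex `x` has distance exactly `k`, so the added players have distance `k + 1`, just
outside the view. With `N = 0` the network consists of the view alone and `x` plays no role. -/
theorem isRealization_extension [Finite V] (hσ : σ.IsLegal) (hG : (network σ).Connected)
    (hk : 1 ≤ k) (hx : N = 0 ∨ (network σ).dist u x = k) :
    IsRealization k σ u (extension k σ u x N) (toExtension k σ u N) := by
  classical
  have hle : ∀ z, (network (extension k σ u x N)).edist (toExtension k σ u N u) z ≤
      (k + 1 : ℕ) := by
    rintro (⟨v, hv⟩ | i)
    · refine (edist_extension_le hσ hG _ v hv rfl).trans ?_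
      rw [mem_kNeighborhood_iff hG] at hv
      exact_mod_cast hv.trans (by omega)
    · rcases hx with rfl | hx
      · exact i.elim0
      · exact edist_extension_leaf_le hσ hG hx i
  refine ⟨extension_isLegal hσ, ?_, ?_, ?_, ?_, ?_⟩
  · have hr : ∀ z, (network (extension k σ u x N)).Reachable (toExtension k σ u N u) z := by
      intro z
      rw [← SimpleGraph.edist_ne_top_iff_reachable]
      exact ne_top_of_le_ne_top (ENat.natCast_ne_top _) (hle z)
    exact (SimpleGraph.connected_iff_exists_forall_reachable _).2 ⟨_, hr⟩
  · intro a ha b hb hab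
    rw [toExtension_of_mem ha, toExtension_of_mem hb] at hab
    simpa using hab
  · ext z
    constructor
    · rintro ⟨v, hv, rfl⟩
      rw [toExtension_of_mem hv]
      refine (edist_extension_le hσ hG _ v hv rfl).trans ?_
      rw [mem_kNeighborhood_iff hG] at hv
      exact_mod_cast hv
    · intro hz
      rcases z with ⟨v, hv⟩ | i
      · exact ⟨v, hv, toExtension_of_mem hv⟩
      · exfalso
        have h1 := le_edist_of_step (G := network (extension k σ u x N))
          (h := Sum.elim (fun v => (network σ).dist u v.1) (fun _ => k + 1))
          (s := toExtension k σ u N u) ?_ ?_ (Sum.inr i)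
        · have h2 := h1.trans hz
          simp only [Sum.elim_inr] at h2
          have : k + 1 ≤ k := by exact_mod_cast h2
          omega
        · have hxd : (network σ).dist u x = k := by
            rcases hx with rfl | hx
            · exact i.elim0
            · exact hx
          rintro (a | j) (b | j') hab <;>
            rw [network_adj_of_legal (extension_isLegal hσ), mem_extension, mem_extension] at hab
          · have h1 := hG.dist_triangle (u := u) (v := a.1) (w := b.1)
            rw [SimpleGraph.dist_eq_one_iff_adj.2 ((network_adj_of_legal hσ).2 hab)] at h1
            exact h1
          · rcases hab with hab | hab
            · exact hab.elim
            · have : a.1 = x := hab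
              simp [this, hxd]
          · rcases hab with hab | hab
            · have : b.1 = x := hab
              simp only [Sum.elim_inl, Sum.elim_inr, this, hxd]
              omega
            · exact hab.elim
          · rcases hab with hab | hab <;> exact hab.elim
        · rw [toExtension_of_mem (self_mem_kNeighborhood k σ u)]
          simp
  · intro a ha b hb
    rw [toExtension_of_mem ha, toExtension_of_mem hb,
      network_adj_of_legal (extension_isLegal hσ), mem_extension, mem_extension,
      network_adj_of_legal hσ]
    rfl
  · ext z
    rw [toExtension_of_mem (self_mem_kNeighborhood k σ u), mem_extension]
    refine Iff.trans ?_ (@Finset.mem_image _ _ (_) _ _ _).symm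
    have hnb : ∀ v ∈ σ u, v ∈ kNeighborhood (network σ) k u := by
      intro v hv
      rw [mem_kNeighborhood_iff hG, SimpleGraph.dist_eq_one_iff_adj.2
        ((network_adj_of_legal hσ).2 (Or.inl hv))]
      exact hk
    constructor
    · rcases z with ⟨v, hv⟩ | i
      · exact fun h => ⟨v, h, toExtension_of_mem hv⟩
      · exact fun h => h.elim
    · rintro ⟨v, hv, rfl⟩
      rw [toExtension_of_mem (hnb v hv)]
      exact hv

theorem cost_extension_le [Fintype V] [inst : Fintype (Extension k σ u N)] (α : ℝ≥0) (hσ : σ.IsLegal)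
    (hG : (network σ).Connected) (hk : 1 ≤ k) (hx : N = 0 ∨ (network σ).dist u x = k) :
    cost α (extension k σ u x N) (toExtension k σ u N u) ≤
      α * (σ u).card + (k * Fintype.card V : ℕ) + (N * (k + 1) : ℕ) := by
  classical
  have := Fintype.ofFinite {v // v ∈ kNeighborhood (network σ) k u}
  rw [cost, (isRealization_extension hσ hG hk hx).strategy_eq, add_assoc]
  have hcast : ∀ {e : ℕ∞} {m : ℕ}, e ≤ m → (e : ℝ≥0∞) ≤ (m : ℝ≥0∞) := by
    intro e m h
    have := ENat.toENNReal_le.2 h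
    simpa using this
  gcongr
  · exact @Finset.card_image_le _ _ _ _ (_)
  · obtain rfl := Subsingleton.elim inst (instFintypeSum _ _)
    rw [Fintype.sum_sum_type]
    refine add_le_add ?_ ?_
    · refine (Finset.sum_le_card_nsmul _ _ (k : ℝ≥0∞) ?_).trans ?_
      · rintro ⟨v, hv⟩ -
        refine hcast ((edist_extension_le hσ hG _ v hv rfl).trans ?_)
        rw [mem_kNeighborhood_iff hG] at hv
        exact_mod_cast hv
      · rw [nsmul_eq_mul, mul_comm]
        push_cast
        gcongr
        rw [Finset.card_univ, Fintype.card_subtype]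
        exact Finset.card_le_univ _
    · refine (Finset.sum_le_card_nsmul _ _ ((k + 1 : ℕ) : ℝ≥0∞) ?_).trans ?_
      · intro i _
        rcases hx with rfl | hx
        · exact i.elim0
        · exact hcast (edist_extension_leaf_le hσ hG hx i)
      · simp [mul_add]

end Realization

theorem deviate_self (τ : Profile V) (u : V) (S : Finset V) : deviate τ u S u = S := by
  classical
  rw [deviate, Function.update_self]

theorem deviate_of_ne (τ : Profile V) {u v : V} (h : v ≠ u) (S : Finset V) :
    deviate τ u S v = τ v := by
  classical
  rw [deviate, Function.update_of_ne h]

theorem deviate_eq_self (τ : Profile V) (u : V) : deviate τ u (τ u) = τ := by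
  classical
  rw [deviate, Function.update_eq_self]

theorem IsRealization.mem_strategy {W : Type} {k : ℕ} {σ : Profile V} {u : V} {τ : Profile W}
    {ι : V → W} (h : IsRealization k σ u τ ι) (z : W) : z ∈ τ (ι u) ↔ ∃ s ∈ σ u, ι s = z := by
  classical
  rw [h.strategy_eq, Finset.mem_image]

/-- The change is a supremum, so a single compatible profile in which the deviation does not pay is
enough. -/
theorem zero_le_worstCaseChange {W : Type} [Fintype W] {k : ℕ} {α : ℝ≥0} {σ : Profile V} {u : V}
    {S : Finset V} {τ : Profile W} {ι : V → W} (h : IsRealization k σ u τ ι)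
    (hS : (S : Set V) ⊆ kNeighborhood (network σ) k u) (hfin : cost α τ (ι u) ≠ ⊤)
    (hle : ∀ S' : Finset W, (∀ z, z ∈ S' ↔ ∃ s ∈ S, ι s = z) → S'.card = S.card →
      cost α τ (ι u) ≤ cost α (deviate τ (ι u) S') (ι u)) :
    0 ≤ worstCaseChange k α σ u S := by
  classical
  refine le_trans ?_ (le_sSup ⟨W, inferInstance, τ, ι, h, rfl⟩)
  rw [EReal.sub_nonneg]
  · have := hle (S.image ι) (fun z => Finset.mem_image)
      (Finset.card_image_of_injOn (h.injOn.mono hS))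
    exact_mod_cast this
  · right
    simpa using hfin
  · left
    simp

end SumNCG

/-! ### Good profiles are equilibria. -/

namespace SumNCG

variable {V : Type}

/-- No edge is bought twice, the network is bipartite and has no cycles of length less than `2k`,
and every edge is bought towards an end that has two clean neighbours in a part of the network of
minimum degree at least two. -/
structure IsGood (k : ℕ) (Z : Set V) (σ : Profile V) : Prop where
  asymm : ∀ u v, v ∈ σ u → u ∉ σ v
  bip : ∃ c : V → Bool, ∀ u v, (network σ).Adj u v → c u ≠ c v
  girth : ∀ j, 2 ≤ j → j < k → cyc (network σ) (2 * j) = ∅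
  core : ∀ v ∈ Z, ∃ p q, p ≠ q ∧ p ∈ Z ∧ q ∈ Z ∧ (network σ).Adj v p ∧ (network σ).Adj v q
  clean : ∀ u, ∀ w ∈ σ u, ∃ y ∈ Z, ∃ z ∈ Z, y ≠ z ∧ IsClean (network σ) k u w y ∧
    IsClean (network σ) k u w z

variable {k : ℕ} {Z : Set V} {σ : Profile V}

theorem IsGood.legal (h : IsGood k Z σ) : σ.IsLegal := fun u hu => h.asymm u u hu hu

theorem IsGood.isThin (h : IsGood k Z σ) (hG : (network σ).Connected) : IsThin (network σ) k :=
  ⟨hG, h.bip, h.girth⟩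

theorem IsGood.adj (h : IsGood k Z σ) {u w : V} (hw : w ∈ σ u) : (network σ).Adj u w :=
  (network_adj_of_asymm h.asymm).2 (Or.inl hw)

/-- A strategy that differs from `σ u` and is not larger leaves out a whole branch. -/
theorem IsGood.exists_branch_disjoint (h : IsGood k Z σ) (hG : (network σ).Connected) {u : V}
    {S : Finset V} (hcard : S.card ≤ (σ u).card) (hne : S ≠ σ u) :
    ∃ w ∈ σ u, w ∉ S ∧ ∃ y ∈ Z, IsClean (network σ) k u w y ∧
      ∀ s ∈ S, s ∉ branch (network σ) k u y := by
  classical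
  by_contra! hcon
  have hT := h.isThin hG
  -- If `S` met both branches of every dropped `w`, these meeting points would be distinct and,
  -- being at distance at least two, outside `σ u`. Hence `|S \ σ u| ≥ 2 |σ u \ S|`, which together
  -- with `|S| ≤ |σ u|` forces `S = σ u`.
  have hchoose : ∀ w, ∃ s t : V, w ∈ σ u \ S → s ≠ t ∧ s ∈ S ∧ t ∈ S ∧
      (∃ y, IsClean (network σ) k u w y ∧ s ∈ branch (network σ) k u y) ∧
      (∃ y, IsClean (network σ) k u w y ∧ t ∈ branch (network σ) k u y) := by
    intro w
    by_cases hw : w ∈ σ u \ S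
    · rw [Finset.mem_sdiff] at hw
      obtain ⟨y, hy, z, hz, hyz, hyc, hzc⟩ := h.clean u w hw.1
      obtain ⟨s, hs, hs'⟩ := hcon w hw.1 hw.2 y hy hyc
      obtain ⟨t, ht, ht'⟩ := hcon w hw.1 hw.2 z hz hzc
      refine ⟨s, t, fun _ => ⟨?_, hs, ht, ⟨y, hyc, hs'⟩, ⟨z, hzc, ht'⟩⟩⟩
      rintro rfl
      exact hyz (hT.branch_disjoint (h.adj hw.1) hyc (h.adj hw.1) hzc hs' ht').2
    · exact ⟨u, u, fun h => absurd h hw⟩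
  choose s t hst using hchoose
  have hbr : ∀ v y, v ∈ branch (network σ) k u y → v ∉ σ u := by
    intro v y hv hmem
    have := hv.1
    rw [SimpleGraph.dist_eq_one_iff_adj.2 (h.adj hmem)] at this
    omega
  have hinj : ∀ w ∈ σ u \ S, ∀ w' ∈ σ u \ S, ∀ v y y', IsClean (network σ) k u w y →
      IsClean (network σ) k u w' y' → v ∈ branch (network σ) k u y →
      v ∈ branch (network σ) k u y' → w = w' := by
    intro w hw w' hw' v y y' hy hy' hv hv'
    exact (hT.branch_disjoint (h.adj (Finset.mem_sdiff.1 hw).1) hy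
      (h.adj (Finset.mem_sdiff.1 hw').1) hy' hv hv').1
  have hs : ((σ u \ S).image s).card = (σ u \ S).card := by
    apply Finset.card_image_of_injOn
    intro w hw w' hw' hww
    obtain ⟨-, -, -, ⟨y, hy, hv⟩, -⟩ := hst w hw
    obtain ⟨-, -, -, ⟨y', hy', hv'⟩, -⟩ := hst w' hw'
    exact hinj w hw w' hw' _ y y' hy hy' hv (hww ▸ hv')
  have ht : ((σ u \ S).image t).card = (σ u \ S).card := by
    apply Finset.card_image_of_injOn
    intro w hw w' hw' hww
    obtain ⟨-, -, -, -, ⟨y, hy, hv⟩⟩ := hst w hw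
    obtain ⟨-, -, -, -, ⟨y', hy', hv'⟩⟩ := hst w' hw'
    exact hinj w hw w' hw' _ y y' hy hy' hv (hww ▸ hv')
  have hdisj : Disjoint ((σ u \ S).image s) ((σ u \ S).image t) := by
    rw [Finset.disjoint_left]
    intro v hv hv'
    obtain ⟨w, hw, rfl⟩ := Finset.mem_image.1 hv
    obtain ⟨w', hw', hww⟩ := Finset.mem_image.1 hv'
    obtain ⟨hne, -, -, ⟨y, hy, hv⟩, -⟩ := hst w hw
    obtain ⟨-, -, -, -, ⟨y', hy', hv'⟩⟩ := hst w' hw'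
    obtain rfl := hinj w hw w' hw' _ y y' hy hy' hv (hww ▸ hv')
    exact hne hww.symm
  have hsub : (σ u \ S).image s ∪ (σ u \ S).image t ⊆ S \ σ u := by
    intro v hv
    rw [Finset.mem_sdiff]
    rcases Finset.mem_union.1 hv with hv | hv
    · obtain ⟨w, hw, rfl⟩ := Finset.mem_image.1 hv
      obtain ⟨-, h1, -, ⟨y, -, h2⟩, -⟩ := hst w hw
      exact ⟨h1, hbr _ y h2⟩
    · obtain ⟨w, hw, rfl⟩ := Finset.mem_image.1 hv
      obtain ⟨-, -, h1, -, ⟨y, -, h2⟩⟩ := hst w hw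
      exact ⟨h1, hbr _ y h2⟩
  have hle := Finset.card_le_card hsub
  rw [Finset.card_union_of_disjoint hdisj, hs, ht] at hle
  have e1 := Finset.card_sdiff_add_card_inter S (σ u)
  have e2 := Finset.card_sdiff_add_card_inter (σ u) S
  rw [Finset.inter_comm] at e2
  have e3 : (σ u \ S).card = 0 := by omega
  rw [Finset.card_eq_zero, Finset.sdiff_eq_empty_iff_subset] at e3
  exact hne (Finset.eq_of_subset_of_card_le e3 hcard).symm

/-- If the new strategy misses the branch of `y` and gives up the edge to `w`, then a player
attached to a visible vertex of that branch at distance `k` moves away. -/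
theorem IsGood.le_edist_deviate [Finite V] (h : IsGood k Z σ) (hG : (network σ).Connected)
    {u w y x : V} {S : Finset V} (hw : w ∈ σ u) (hwS : w ∉ S) (huS : u ∉ S)
    (hSk : (S : Set V) ⊆ kNeighborhood (network σ) k u) (hy : IsClean (network σ) k u w y)
    (hS : ∀ s ∈ S, s ∉ branch (network σ) k u y) (hx : x ∈ branch (network σ) k u y)
    (hxk : (network σ).dist u x = k) {N : ℕ} (i : Fin N) {S' : Finset (Extension k σ u N)}
    (hS' : ∀ z, z ∈ S' ↔ ∃ s ∈ S, toExtension k σ u N s = z) :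
    ((k + 2 : ℕ) : ℕ∞) ≤ (network (deviate (extension k σ u x N) (toExtension k σ u N u)
      S')).edist (toExtension k σ u N u) (Sum.inr i) := by
  classical
  have hT := h.isThin hG
  have huw := h.adj hw
  have hu0 := self_mem_kNeighborhood k σ u
  let B := branch (network σ) k u y
  have hub : u ∉ B := fun hm => by
    have := hm.1; simp at this
  have hlvl1 : ∀ v, (network σ).Adj u v → v ∉ B := fun v hv hm => by
    have := hm.1
    rw [SimpleGraph.dist_eq_one_iff_adj.2 hv] at this
    omega
  -- A lower bound for the distances after the deviation: `w` can no longer be reached in one step,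
  -- and the branch can be entered only through `w`, so its levels move up by one. All other visible
  -- vertices get the trivial bound `1`. The purchases in `S` go to vertices of value `1` only.
  let g : V → ℕ := fun v => if v = u then 0 else if v = w then 2 else
    if v ∈ B then (network σ).dist u v + 1 else 1
  have gu : g u = 0 := if_pos rfl
  have gw : g w = 2 := by simp [g, huw.ne.symm]
  have gB : ∀ v ∈ B, g v = (network σ).dist u v + 1 := by
    intro v hv
    have h1 : v ≠ u := fun e => hub (e ▸ hv)
    have h2 : v ≠ w := fun e => hlvl1 w huw (e ▸ hv)
    simp [g, h1, h2, hv]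
  have g1 : ∀ v, v ≠ u → v ≠ w → v ∉ B → g v = 1 := by
    intro v h1 h2 h3
    simp [g, h1, h2, h3]
  have gpos : ∀ v, v ≠ u → 1 ≤ g v := by
    intro v hv
    simp only [g, if_neg hv]
    split_ifs <;> omega
  have hstep : ∀ v v', (network σ).Adj v v' → v ≠ u → v' ≠ u →
      (network σ).dist u v' ≤ k → (network σ).dist u v ≤ k → g v' ≤ g v + 1 := by
    intro v v' hadj hv hv' hk1 hk2
    by_cases hvB' : v' ∈ B
    · rcases hT.adj_branch huw hy hvB' hadj.symm hk2 with ⟨rfl, rfl⟩ | hvB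
      · rw [gw, gB _ hvB', hT.dist_eq_two huw hy]
      · rw [gB _ hvB, gB _ hvB']
        rcases hT.dist_step u hadj with h1 | h1 <;> omega
    · by_cases hvw' : v' = w
      · subst hvw'
        rw [gw]
        have := gpos v hv
        omega
      · rw [g1 v' hv' hvw' hvB']
        omega
  have hbound := le_edist_of_step
    (G := network (deviate (extension k σ u x N) (toExtension k σ u N u) S'))
    (h := Sum.elim (fun v => g v.1) (fun _ => k + 2)) (s := toExtension k σ u N u) ?_ ?_ (Sum.inr i)
  · simpa using hbound
  · have hbuy : ∀ a b, b ∈ deviate (extension k σ u x N) (toExtension k σ u N u) S' a →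
        (Sum.elim (fun v => g v.1) (fun _ => k + 2) : Extension k σ u N → ℕ) b ≤
          (Sum.elim (fun v => g v.1) (fun _ => k + 2) : Extension k σ u N → ℕ) a + 1 ∧
        (Sum.elim (fun v => g v.1) (fun _ => k + 2) : Extension k σ u N → ℕ) a ≤
          (Sum.elim (fun v => g v.1) (fun _ => k + 2) : Extension k σ u N → ℕ) b + 1 := by
      intro a b hab
      by_cases ha : a = toExtension k σ u N u
      · subst ha
        rw [deviate_self, hS'] at hab
        obtain ⟨s, hs, rfl⟩ := hab
        rw [toExtension_of_mem (hSk hs), toExtension_of_mem hu0]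
        simp only [Sum.elim_inl]
        rw [gu, g1 s (fun e => huS (e ▸ hs)) (fun e => hwS (e ▸ hs)) (hS s hs)]
        omega
      · rw [deviate_of_ne _ ha, mem_extension] at hab
        rcases a with ⟨v, hv⟩ | j <;> rcases b with ⟨v', hv'⟩ | j'
        · have hbuy : v' ∈ σ v := hab
          have hadj := h.adj hbuy
          have hvu : v ≠ u := by
            rintro rfl
            exact ha (toExtension_of_mem hv).symm
          rw [mem_kNeighborhood_iff hG] at hv hv'
          simp only [Sum.elim_inl]
          by_cases hvu' : v' = u
          · subst hvu'
            -- An edge that `v` buys to `u` survives the deviation; `v` is not `w`, because `u` pays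
            -- for the edge `uw` and no edge is bought twice.
            rw [gu, g1 v hvu (fun e => h.asymm _ _ hw (e ▸ hbuy)) (hlvl1 v hadj.symm)]
            omega
          · exact ⟨hstep v v' hadj hvu hvu' hv' hv, hstep v' v hadj.symm hvu' hvu hv hv'⟩
        · exact hab.elim
        · have : v' = x := hab
          subst this
          simp only [Sum.elim_inl, Sum.elim_inr]
          rw [gB v' hx, hxk]
          omega
        · exact hab.elim
    intro a b hab
    rw [network, SimpleGraph.fromRel_adj] at hab
    rcases hab.2 with h1 | h1
    · exact (hbuy a b h1).1
    · exact (hbuy b a h1).2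
  · rw [toExtension_of_mem hu0]
    exact gu

theorem cost_extension_ne_top [Fintype V] {u x : V} {N : ℕ} [Fintype (Extension k σ u N)] (α : ℝ≥0)
    (hσ : σ.IsLegal) (hG : (network σ).Connected) (hk : 1 ≤ k)
    (hx : N = 0 ∨ (network σ).dist u x = k) :
    cost α (extension k σ u x N) (toExtension k σ u N u) ≠ ⊤ := by
  refine ne_top_of_le_ne_top ?_ (cost_extension_le α hσ hG hk hx)
  exact ENNReal.add_ne_top.2 ⟨ENNReal.add_ne_top.2 ⟨ENNReal.mul_ne_top ENNReal.coe_ne_top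
    (ENNReal.natCast_ne_top _), ENNReal.natCast_ne_top _⟩, ENNReal.natCast_ne_top _⟩

/-- To buy more edges does not pay if `α` is large. -/
theorem zero_le_worstCaseChange_of_card_lt [Fintype V] {α : ℝ≥0}
    (hα : (k : ℝ≥0) * (Fintype.card V : ℝ≥0) ≤ α) (hσ : σ.IsLegal) (hG : (network σ).Connected)
    (hk : 1 ≤ k) {u : V} {S : Finset V} (hSk : (S : Set V) ⊆ kNeighborhood (network σ) k u)
    (hcard : (σ u).card < S.card) : 0 ≤ worstCaseChange k α σ u S := by
  have := Fintype.ofFinite (Extension k σ u 0)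
  refine zero_le_worstCaseChange (isRealization_extension (x := u) (N := 0) hσ hG hk (Or.inl rfl))
    hSk (cost_extension_ne_top α hσ hG hk (Or.inl rfl)) fun S' _ hS' =>
    (cost_extension_le α hσ hG hk (Or.inl rfl)).trans ?_
  rw [cost, deviate_self, hS']
  refine le_trans ?_ le_self_add
  have h2 : ((k * Fintype.card V : ℕ) : ℝ≥0∞) ≤ α := by
    exact_mod_cast ENNReal.coe_le_coe.2 hα
  calc (α : ℝ≥0∞) * (σ u).card + (k * Fintype.card V : ℕ) + (0 * (k + 1) : ℕ)
      ≤ (α : ℝ≥0∞) * (σ u).card + α := by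
        rw [zero_mul, Nat.cast_zero, add_zero]; gcongr
    _ = (α : ℝ≥0∞) * ((σ u).card + 1 : ℕ) := by push_cast; ring
    _ ≤ _ := by
        gcongr
        exact hcard

theorem zero_le_worstCaseChange_self [Fintype V] {α : ℝ≥0} (hσ : σ.IsLegal)
    (hG : (network σ).Connected) (hk : 1 ≤ k) (u : V) : 0 ≤ worstCaseChange k α σ u (σ u) := by
  have := Fintype.ofFinite (Extension k σ u 0)
  have hr := isRealization_extension (u := u) (x := u) (N := 0) hσ hG hk (Or.inl rfl)
  refine zero_le_worstCaseChange hr ?_ (cost_extension_ne_top α hσ hG hk (Or.inl rfl))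
    fun S' hS' _ => le_of_eq ?_
  · intro v hv
    rw [mem_kNeighborhood_iff hG, SimpleGraph.dist_eq_one_iff_adj.2
      ((network_adj_of_legal hσ).2 (Or.inl hv))]
    exact hk
  · have : S' = extension k σ u u 0 (toExtension k σ u 0 u) := by
      ext z; rw [hS', hr.mem_strategy]
    rw [this, deviate_eq_self]

theorem IsGood.isLKE [Fintype V] {α : ℝ≥0} (h : IsGood k Z σ) (hG : (network σ).Connected)
    (hk : 2 ≤ k) (hα : (k : ℝ≥0) * (Fintype.card V : ℝ≥0) ≤ α) : IsLKE k α σ := by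
  classical
  refine ⟨h.legal, hG, fun u S huS hSk => ?_⟩
  rcases lt_or_ge (σ u).card S.card with hcard | hcard
  · exact zero_le_worstCaseChange_of_card_lt hα h.legal hG (by omega) hSk hcard
  by_cases hne : S = σ u
  · rw [hne]
    exact zero_le_worstCaseChange_self h.legal hG (by omega) u
  obtain ⟨w, hw, hwS, y, hyZ, hy, hS⟩ := h.exists_branch_disjoint hG hcard hne
  obtain ⟨x, hx, hxk⟩ := (h.isThin hG).exists_mem_branch_dist_eq h.core hk (h.adj hw) hy hyZ
  -- Each of the `N` unseen players moves away by at least one, so `N` only has to exceed everything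
  -- `u` could save on edges and on visible players.
  obtain ⟨N, hN⟩ := ENNReal.exists_nat_gt (r := (α : ℝ≥0∞) * (σ u).card +
    (k * Fintype.card V : ℕ)) (ENNReal.add_ne_top.2 ⟨ENNReal.mul_ne_top ENNReal.coe_ne_top
    (ENNReal.natCast_ne_top _), ENNReal.natCast_ne_top _⟩)
  have := Fintype.ofFinite {v // v ∈ kNeighborhood (network σ) k u}
  refine zero_le_worstCaseChange (isRealization_extension (x := x) (N := N) h.legal hG (by omega)
      (Or.inr hxk)) hSk (cost_extension_ne_top α h.legal hG (by omega) (Or.inr hxk))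
    fun S' hS' _ => (cost_extension_le α h.legal hG (by omega) (Or.inr hxk)).trans ?_
  rw [cost, Fintype.sum_sum_type]
  refine le_trans ?_ le_add_self
  refine le_trans ?_ le_add_self
  refine le_trans ?_ (Finset.card_nsmul_le_sum _ _ ((k + 2 : ℕ) : ℝ≥0∞) ?_)
  · rw [Finset.card_univ, Fintype.card_fin, nsmul_eq_mul]
    calc _ ≤ (N : ℝ≥0∞) + (N * (k + 1) : ℕ) := by gcongr
      _ = _ := by push_cast; ring
  · intro i _
    have := ENat.toENNReal_le.2
      (h.le_edist_deviate hG hw hwS huS hSk hy hS hx hxk i hS')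
    simpa using this

end SumNCG

/-! ### Construction of connected good profiles with many edges. -/

namespace SumNCG

variable {V : Type} {k : ℕ} {Z : Set V} {σ : Profile V}

open Classical in
/-- `r` buys one more edge, to `w`. -/
noncomputable def buyEdge (σ : Profile V) (r w : V) : Profile V :=
  Function.update σ r (insert w (σ r))

theorem mem_buyEdge {r w u v : V} : v ∈ buyEdge σ r w u ↔ v ∈ σ u ∨ u = r ∧ v = w := by
  classical
  by_cases h : u = r
  · subst h
    simp [buyEdge, or_comm]
  · simp [buyEdge, h]

theorem network_buyEdge {r w : V} :
    network (buyEdge σ r w) = network σ ⊔ SimpleGraph.edge r w := by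
  ext a b
  simp only [network, SimpleGraph.sup_adj, SimpleGraph.fromRel_adj, SimpleGraph.edge_adj,
    mem_buyEdge]
  tauto

/-- The new edge is a bridge: it creates no cycle, so old clean vertices stay clean and every old
neighbour of `w` is clean for it. -/
theorem IsGood.buyEdge (h : IsGood k Z σ) (hk : 2 ≤ k) {r w : V} (hw : w ∈ Z)
    (hr : ¬ (network σ).Reachable r w) : IsGood k Z (buyEdge σ r w) := by
  classical
  have hrw : r ≠ w := by rintro rfl; exact hr (SimpleGraph.Reachable.refl _)
  have hnadj : ¬ (network σ).Adj r w := fun h => hr h.reachable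
  have hcyc : ∀ m, 3 ≤ m → cyc (network (SumNCG.buyEdge σ r w)) m ⊆ cyc (network σ) m := by
    intro m hm
    rw [network_buyEdge]
    exact cyc_sup_edge_of_not_reachable hm hr
  have hle : network σ ≤ network (SumNCG.buyEdge σ r w) := by
    rw [network_buyEdge]; exact le_sup_left
  refine ⟨?_, ?_, ?_, ?_, ?_⟩
  · intro u v huv hvu
    rw [mem_buyEdge] at huv hvu
    rcases huv with huv | ⟨rfl, rfl⟩
    · rcases hvu with hvu | ⟨rfl, rfl⟩
      · exact h.asymm u v huv hvu
      · exact hnadj (h.adj huv).symm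
    · rcases hvu with hvu | ⟨rfl, -⟩
      · exact hnadj (h.adj hvu).symm
      · exact hrw rfl
  · obtain ⟨c, hc⟩ := h.bip
    by_cases hcrw : c r = c w
    -- If the two ends have the same colour, the colours are exchanged on the component of `r`.
    · refine ⟨fun v => if (network σ).Reachable r v then !(c v) else c v, ?_⟩
      intro a b hab
      rw [network_buyEdge, SimpleGraph.sup_adj, SimpleGraph.edge_adj] at hab
      rcases hab with hab | ⟨⟨rfl, rfl⟩ | ⟨rfl, rfl⟩, -⟩
      · have hiff : (network σ).Reachable r a ↔ (network σ).Reachable r b :=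
          ⟨fun h => h.trans hab.reachable, fun h => h.trans hab.symm.reachable⟩
        have := hc a b hab
        by_cases hra : (network σ).Reachable r a
        · simp [hra, hiff.1 hra, this]
        · simp [hra, (not_congr hiff).1 hra, this]
      · simp [hr, hcrw]
      · simp [hr, hcrw]
    · refine ⟨c, ?_⟩
      intro a b hab
      rw [network_buyEdge, SimpleGraph.sup_adj, SimpleGraph.edge_adj] at hab
      rcases hab with hab | ⟨⟨rfl, rfl⟩ | ⟨rfl, rfl⟩, -⟩
      · exact hc a b hab
      · exact hcrw
      · exact Ne.symm hcrw
  · intro j h1 h2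
    exact Set.subset_eq_empty (hcyc _ (by omega)) (h.girth j h1 h2)
  · intro v hv
    obtain ⟨p, q, h1, h2, h3, h4, h5⟩ := h.core v hv
    exact ⟨p, q, h1, h2, h3, hle h4, hle h5⟩
  · intro u v hv
    rw [mem_buyEdge] at hv
    rcases hv with hv | ⟨rfl, rfl⟩
    · obtain ⟨y, hy, z, hz, hyz, hyc, hzc⟩ := h.clean u v hv
      exact ⟨y, hy, z, hz, hyz,
        ⟨hle hyc.adj, hyc.ne, fun f hf => hyc.not_cyc f (hcyc _ (by omega) hf)⟩,
        ⟨hle hzc.adj, hzc.ne, fun f hf => hzc.not_cyc f (hcyc _ (by omega) hf)⟩⟩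
    · obtain ⟨p, q, h1, h2, h3, h4, h5⟩ := h.core v hw
      have hclean : ∀ y, (network σ).Adj v y → IsClean (network (SumNCG.buyEdge σ u v)) k u v y := by
        intro y hy
        refine ⟨hle hy, ?_, ?_⟩
        · rintro rfl
          exact hnadj hy.symm
        · intro f hf hf1 hf2
          have := (hcyc _ (by omega) hf).2 (-1)
          rw [neg_add_cancel, hf1, hf2] at this
          exact absurd this hnadj
      exact ⟨p, h2, q, h3, h1, hclean p h4, hclean q h5⟩

/-- A good profile can be made connected by additional edges. -/
theorem IsGood.exists_connected [Fintype V] (h : IsGood k Z σ) (hk : 2 ≤ k) (hZ : Z.Nonempty) :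
    ∃ σ', IsGood k Z σ' ∧ (network σ').Connected ∧ ∑ u, (σ u).card ≤ ∑ u, (σ' u).card := by
  classical
  have : Nonempty {σ : Profile V // IsGood k Z σ} := ⟨⟨σ, h⟩⟩
  -- With the most purchases among good profiles the network is connected, since otherwise another
  -- bridge to `w` could be bought.
  obtain ⟨⟨σ', h'⟩, hmax⟩ := Finite.exists_max
    (fun σ : {σ : Profile V // IsGood k Z σ} => ∑ u, (σ.1 u).card)
  refine ⟨σ', h', ?_, hmax ⟨σ, h⟩⟩
  obtain ⟨w, hw⟩ := hZ
  refine (SimpleGraph.connected_iff_exists_forall_reachable _).2 ⟨w, fun r => ?_⟩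
  by_contra hr
  have hr' : ¬ (network σ').Reachable r w := fun h => hr h.symm
  have h1 := hmax ⟨_, h'.buyEdge hk hw hr'⟩
  have h2 : ∑ u, (σ' u).card < ∑ u, (SumNCG.buyEdge σ' r w u).card := by
    apply Finset.sum_lt_sum
    · intro u _
      exact Finset.card_le_card fun v hv => mem_buyEdge.2 (Or.inl hv)
    · refine ⟨r, Finset.mem_univ r, Finset.card_lt_card ?_⟩
      rw [Finset.ssubset_iff_of_subset fun v hv => mem_buyEdge.2 (Or.inl hv)]
      refine ⟨w, mem_buyEdge.2 (Or.inr ⟨rfl, rfl⟩), fun hmem => hr' ?_⟩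
      exact (h'.adj hmem).reachable
  simp only at h1
  omega

open Classical in
/-- Every edge of `H` is bought by its smaller end. -/
noncomputable def orient [Fintype V] [LinearOrder V] (H : SimpleGraph V) : Profile V :=
  fun u => Finset.univ.filter fun v => H.Adj u v ∧ u < v

theorem mem_orient [Fintype V] [LinearOrder V] {H : SimpleGraph V} {u v : V} :
    v ∈ orient H u ↔ H.Adj u v ∧ u < v := by
  simp [orient]

theorem network_orient [Fintype V] [LinearOrder V] (H : SimpleGraph V) :
    network (orient H) = H := by
  ext a b
  rw [network, SimpleGraph.fromRel_adj, mem_orient, mem_orient]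
  constructor
  · rintro ⟨-, h | h⟩
    · exact h.1
    · exact h.1.symm
  · intro h
    refine ⟨h.ne, ?_⟩
    rcases lt_or_gt_of_ne h.ne with h' | h'
    · exact Or.inl ⟨h, h'⟩
    · exact Or.inr ⟨h.symm, h'⟩

theorem ncard_edgeSet_le_sum_orient [Fintype V] [LinearOrder V] (H : SimpleGraph V) :
    H.edgeSet.ncard ≤ ∑ u, (orient H u).card := by
  classical
  rw [← Finset.card_sigma, ← Set.ncard_coe_finset]
  refine le_trans (Set.ncard_le_ncard ?_ (Set.toFinite _))
    (Set.ncard_image_le (f := fun p : (_ : V) × V => s(p.1, p.2)) (Set.toFinite _))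
  intro e
  induction e using Sym2.ind with
  | _ x y =>
    intro h
    have h : H.Adj x y := h
    rcases lt_or_gt_of_ne h.ne with h' | h'
    · exact ⟨⟨x, y⟩, by simp [mem_orient, h, h'], rfl⟩
    · exact ⟨⟨y, x⟩, by simp [mem_orient, h.symm, h'], Sym2.eq_swap⟩

theorem isGood_orient [Fintype V] [LinearOrder V] {c : V → Bool} {D T : ℕ} {G H : SimpleGraph V}
    (hk : 2 ≤ k) (hG : Admissible c k D G)
    (hT : ∀ u w, G.Adj u w → (arc G (2 * k) u w).ncard ≤ T) (hH : H ≤ G)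
    (hHZ : ∀ u v, H.Adj u v → u ∈ Z) (hZ : ∀ v ∈ Z, T + 3 ≤ (H.neighborSet v).ncard) :
    IsGood k Z (orient H) := by
  classical
  have hadm := hG.mono hH
  refine ⟨?_, ⟨c, ?_⟩, ?_, ?_, ?_⟩
  · intro u v h1 h2
    rw [mem_orient] at h1 h2
    exact lt_asymm h1.2 h2.2
  · rw [network_orient]; exact hadm.bip
  · rw [network_orient]; exact hadm.girth
  · intro v hv
    rw [network_orient]
    have h1 : 1 < (H.neighborSet v).ncard := by have := hZ v hv; omega
    obtain ⟨p, hp, q, hq, hpq⟩ := (Set.one_lt_ncard (Set.toFinite _)).1 h1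
    exact ⟨p, q, hpq, hHZ p v (H.adj_symm hp), hHZ q v (H.adj_symm hq), hp, hq⟩
  · intro u w hw
    rw [network_orient]
    rw [mem_orient] at hw
    have : NeZero (2 * k) := ⟨by omega⟩
    -- At most `T + 1` neighbours of `w` are not clean: `u`, and the successors of `w` on the at
    -- most `T` arcs that `uw` closes. Degree `T + 3` leaves two clean ones.
    set bad : Set V := insert u ((fun f : ZMod (2 * k) → V => f 1) '' arc G (2 * k) u w) with hbad
    have h1 : bad.ncard ≤ T + 1 :=
      (Set.ncard_insert_le _ _).trans (Nat.add_le_add_right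
        ((Set.ncard_image_le (Set.toFinite _)).trans (hT u w (hH hw.1))) 1)
    have h2 := hZ w (hHZ w u hw.1.symm)
    have h3 := Set.le_ncard_sdiff bad (H.neighborSet w) (Set.toFinite _)
    have h4 : 1 < (H.neighborSet w \ bad).ncard := by omega
    obtain ⟨y, hy, z, hz, hyz⟩ := (Set.one_lt_ncard (Set.toFinite _)).1 h4
    have hclean : ∀ y ∈ H.neighborSet w \ bad, IsClean H k u w y := by
      rintro y ⟨hy, hyb⟩
      refine ⟨hy, fun e => hyb (Or.inl e), ?_⟩
      rintro f hf hf1 hf2 rfl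
      have hf' := cyc_mono hH _ hf
      exact hyb (Or.inr ⟨f, ⟨hf'.1, hf1, hf2, fun i _ => hf'.2 i⟩, rfl⟩)
    exact ⟨y, hHZ y w (H.adj_symm hy.1), z, hHZ z w (H.adj_symm hz.1), hyz, hclean y hy,
      hclean z hz⟩

/-- Equilibria with many edges. -/
theorem exists_isLKE_of_card [Fintype V] [LinearOrder V] (c : V → Bool) {T N : ℕ} (hk : 2 ≤ k)
    (hT : 3 ≤ T) (hA : N ≤ {v | c v = true}.ncard) (hB : N ≤ {v | c v = false}.ncard)
    (hV : Fintype.card V ≤ 3 * N) (hN : (320 * T) ^ (2 * k - 2) ≤ N) {α : ℝ≥0}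
    (hα : (k : ℝ≥0) * (Fintype.card V : ℝ≥0) ≤ α) :
    ∃ σ : Profile V, IsLKE k α σ ∧ 2 * N * T ≤ ∑ u, (σ u).card := by
  obtain ⟨G, hG, hGT, hGe⟩ := exists_dense c hk (by omega : 1 ≤ T) hA hB hN
  obtain ⟨H, Z, hH, hHZ, hZ, hHe⟩ := exists_core G (T + 3)
  have hN0 : 0 < N := lt_of_lt_of_le (by positivity) hN
  have he : 2 * N * T ≤ H.edgeSet.ncard := by
    rw [Nat.card_eq_fintype_card] at hHe
    -- Here `T ≥ 3` is used as `T + 3 ≤ 2T`: the core loses at most `6NT` of the `8NT` edges.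
    have h1 : Fintype.card V * (T + 3) ≤ 3 * N * (2 * T) := Nat.mul_le_mul hV (by omega)
    have h2 : 3 * N * (2 * T) = 6 * (N * T) := by ring
    have h3 : 8 * N * T = 8 * (N * T) := by ring
    have h4 : 2 * N * T = 2 * (N * T) := by ring
    omega
  have hZne : Z.Nonempty := by
    have : 0 < H.edgeSet.ncard := lt_of_lt_of_le (by positivity) he
    obtain ⟨e, he⟩ := (Set.ncard_pos (Set.toFinite _)).1 this
    induction e using Sym2.ind with
    | _ x y => exact ⟨x, hHZ x y he⟩
  obtain ⟨σ, hσ, hconn, hle⟩ := (isGood_orient hk hG hGT hH hHZ hZ).exists_connected hk hZne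
  exact ⟨σ, hσ.isLKE hconn hk hα, he.trans ((ncard_edgeSet_le_sum_orient H).trans hle)⟩

end SumNCG

/-! ### The star, the price of anarchy and the constants. -/

namespace SumNCG

variable {V : Type} {k : ℕ}

open Classical in
/-- The star in which the centre `r` buys all edges. -/
noncomputable def star [Fintype V] (r : V) : Profile V :=
  fun u => if u = r then Finset.univ.erase r else ∅

theorem mem_star [Fintype V] {r u v : V} : v ∈ star r u ↔ u = r ∧ v ≠ r := by
  by_cases h : u = r <;> simp [star, h]

theorem star_isLegal [Fintype V] (r : V) : (star r).IsLegal := by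
  intro u h
  rw [mem_star] at h
  exact h.2 h.1

theorem network_star_adj [Fintype V] {r u v : V} :
    (network (star r)).Adj u v ↔ u ≠ v ∧ (u = r ∨ v = r) := by
  rw [network_adj_of_legal (star_isLegal r), mem_star, mem_star]
  constructor
  · rintro (⟨rfl, h⟩ | ⟨rfl, h⟩)
    · exact ⟨h.symm, Or.inl rfl⟩
    · exact ⟨h, Or.inr rfl⟩
  · rintro ⟨h, rfl | rfl⟩
    · exact Or.inl ⟨rfl, h.symm⟩
    · exact Or.inr ⟨rfl, h⟩

theorem edist_star_centre_le [Fintype V] (r v : V) : (network (star r)).edist r v ≤ 1 := by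
  rw [SimpleGraph.edist_le_one_iff_adj_or_eq, network_star_adj]
  by_cases h : r = v
  · exact Or.inr h
  · exact Or.inl ⟨h, Or.inl rfl⟩

theorem edist_star_le [Fintype V] (r u v : V) : (network (star r)).edist u v ≤ 2 := by
  refine (SimpleGraph.edist_triangle (v := r)).trans ?_
  rw [SimpleGraph.edist_comm, ← one_add_one_eq_two]
  exact add_le_add (edist_star_centre_le r u) (edist_star_centre_le r v)

theorem network_star_connected [Fintype V] (r : V) : (network (star r)).Connected := by
  refine (SimpleGraph.connected_iff_exists_forall_reachable _).2 ⟨r, fun v => ?_⟩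
  rw [← SimpleGraph.edist_ne_top_iff_reachable]
  exact ne_top_of_le_ne_top ENat.one_ne_top (edist_star_centre_le r v)

theorem sum_card_star [Fintype V] (r : V) :
    ∑ u, (star r u).card = Fintype.card V - 1 := by
  classical
  rw [Finset.sum_eq_single r]
  · simp [star]
  · intro u _ hu
    simp [star, hu]
  · simp

theorem optimalCost_le [Fintype V] [Nonempty V] {α : ℝ≥0} (hk : 2 ≤ k)
    (hα : (k : ℝ≥0) * (Fintype.card V : ℝ≥0) ≤ α) :
    optimalCost V α ≤ α * ((2 * Fintype.card V : ℕ) : ℝ≥0∞) := by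
  obtain ⟨r⟩ := ‹Nonempty V›
  refine (iInf₂_le (star r) (star_isLegal r)).trans ?_
  simp only [socialCost, cost]
  rw [Finset.sum_add_distrib, ← Finset.mul_sum, ← Nat.cast_sum, sum_card_star]
  have h1 : ∑ u : V, ∑ v : V, ((network (star r)).edist u v : ℝ≥0∞) ≤
      (Fintype.card V : ℝ≥0∞) * ((Fintype.card V : ℝ≥0∞) * 2) := by
    rw [← nsmul_eq_mul, ← nsmul_eq_mul]
    refine Finset.sum_le_card_nsmul _ _ _ fun u _ => Finset.sum_le_card_nsmul _ _ _ fun v _ => ?_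
    have := ENat.toENNReal_le.2 (edist_star_le r u v)
    simpa using this
  have h2 : (Fintype.card V : ℝ≥0∞) * 2 ≤ α := by
    have : (Fintype.card V : ℝ≥0) * 2 ≤ α := by
      refine le_trans ?_ hα
      rw [mul_comm]
      gcongr
      exact_mod_cast hk
    exact_mod_cast ENNReal.coe_le_coe.2 this
  calc _ ≤ (α : ℝ≥0∞) * (Fintype.card V : ℕ) + (Fintype.card V : ℝ≥0∞) * α := by
        gcongr
        · omega
        · exact h1.trans (by gcongr)
    _ = _ := by push_cast; ring

/-- The price of anarchy is at least a constant times the average number of edges bought. -/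
theorem le_priceOfAnarchy [Fintype V] [Nonempty V] {α : ℝ≥0} (hk : 2 ≤ k)
    (hα : (k : ℝ≥0) * (Fintype.card V : ℝ≥0) ≤ α) {σ : Profile V} (h : IsLKE k α σ) {m : ℕ}
    (hm : m ≤ ∑ u, (σ u).card) :
    (((m : ℝ≥0) / ((2 * Fintype.card V : ℕ) : ℝ≥0) : ℝ≥0) : ℝ≥0∞) ≤ priceOfAnarchy V k α := by
  have hn : 0 < Fintype.card V := Fintype.card_pos
  have hα0 : α ≠ 0 := by
    rintro rfl
    have : 0 < (k : ℝ≥0) * (Fintype.card V : ℝ≥0) := by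
      have : 0 < k := by omega
      positivity
    exact absurd hα (not_le.2 this)
  refine le_trans ?_ (le_iSup₂ (f := fun (σ : Profile V) (_ : IsLKE k α σ) =>
    socialCost α σ / optimalCost V α) σ h)
  have h1 : (α : ℝ≥0∞) * m ≤ socialCost α σ := by
    simp only [socialCost, cost]
    rw [Finset.sum_add_distrib, ← Finset.mul_sum, ← Nat.cast_sum]
    refine le_trans ?_ le_self_add
    gcongr
  refine le_trans ?_ (ENNReal.div_le_div h1 (optimalCost_le hk hα))
  rw [ENNReal.mul_div_mul_left _ _ (by simpa using hα0) ENNReal.coe_ne_top,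
    ENNReal.coe_div (by positivity)]
  simp

/-- Only the centre can drop an edge, and the leaf concerned is then isolated, at infinite cost.
This equilibrium serves for small `n`. -/
theorem star_isLKE [Fintype V] {α : ℝ≥0} (hk : 1 ≤ k)
    (hα : (k : ℝ≥0) * (Fintype.card V : ℝ≥0) ≤ α) (r : V) : IsLKE k α (star r) := by
  classical
  have hG := network_star_connected r
  have hσ := star_isLegal r
  refine ⟨hσ, hG, fun u S huS hSk => ?_⟩
  rcases lt_or_ge (star r u).card S.card with hcard | hcard
  · exact zero_le_worstCaseChange_of_card_lt hα hσ hG hk hSk hcard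
  by_cases hne : S = star r u
  · rw [hne]
    exact zero_le_worstCaseChange_self hσ hG hk u
  have hw : ∃ w ∈ star r u, w ∉ S := by
    by_contra! hcon
    exact hne (Finset.eq_of_subset_of_card_le hcon hcard).symm
  obtain ⟨w, hw, hwS⟩ := hw
  obtain ⟨rfl, hwr⟩ := mem_star.1 hw
  have hr := isRealization_extension (u := u) (x := u) (N := 0) hσ hG hk (Or.inl rfl)
  have := Fintype.ofFinite (Extension k (star u) u 0)
  refine zero_le_worstCaseChange hr hSk (cost_extension_ne_top α hσ hG hk (Or.inl rfl))
    fun S' hS' _ => ?_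
  have hwk : ∀ v, v ∈ kNeighborhood (network (star u)) k u := fun v =>
    (edist_star_centre_le u v).trans (by exact_mod_cast hk)
  have htop : (network (deviate (extension k (star u) u u 0) (toExtension k (star u) u 0 u)
      S')).edist (toExtension k (star u) u 0 u) (Sum.inl ⟨w, hwk w⟩) = ⊤ := by
    -- The function with an arbitrary value `M` at `w` and `0` elsewhere is constant along edges,
    -- since no edge meets `w`.
    rw [ENat.eq_top_iff_forall_ge]
    intro M
    have := le_edist_of_step (G := network (deviate (extension k (star u) u u 0)
      (toExtension k (star u) u 0 u) S')) (h := fun z => if z = Sum.inl ⟨w, hwk w⟩ then M else 0)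
      (s := toExtension k (star u) u 0 u) ?_ ?_ (Sum.inl ⟨w, hwk w⟩)
    · simpa using this
    · have hbuy : ∀ a b, b ∈ deviate (extension k (star u) u u 0)
          (toExtension k (star u) u 0 u) S' a →
          a ≠ Sum.inl ⟨w, hwk w⟩ ∧ b ≠ Sum.inl ⟨w, hwk w⟩ := by
        intro a b hab
        by_cases ha : a = toExtension k (star u) u 0 u
        · subst ha
          rw [deviate_self, hS'] at hab
          obtain ⟨s, hs, rfl⟩ := hab
          rw [toExtension_of_mem (hwk s), toExtension_of_mem (hwk u)]
          refine ⟨fun e => hwr ?_, fun e => hwS ?_⟩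
          · simpa using e.symm
          · have : s = w := by simpa using e
            exact this ▸ hs
        · rw [deviate_of_ne _ ha, mem_extension] at hab
          rcases a with ⟨v, hv⟩ | j
          · rcases b with ⟨v', hv'⟩ | j'
            · have h1 : v' ∈ star u v := hab
              rw [mem_star] at h1
              obtain ⟨rfl, -⟩ := h1
              exact absurd (toExtension_of_mem hv).symm ha
            · exact hab.elim
          · exact j.elim0
      intro a b hab
      rw [network, SimpleGraph.fromRel_adj] at hab
      have : b ≠ Sum.inl ⟨w, hwk w⟩ := by
        rcases hab.2 with h1 | h1
        · exact (hbuy a b h1).2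
        · exact (hbuy b a h1).1
      simp [this]
    · rw [toExtension_of_mem (hwk u)]
      have : u ≠ w := hwr.symm
      simp [this]
  have : cost α (deviate (extension k (star u) u u 0) (toExtension k (star u) u 0 u) S')
      (toExtension k (star u) u 0 u) = ⊤ := by
    rw [cost]
    refine ENNReal.add_eq_top.2 (Or.inr (ENNReal.sum_eq_top.2 ⟨Sum.inl ⟨w, hwk w⟩, Finset.mem_univ _, ?_⟩))
    rw [htop]; rfl
  rw [this]
  exact le_top

theorem priceOfAnarchy_lower_bound {k n : ℕ} {α : ℝ≥0} (hk : 2 ≤ k) (hn : 2 ≤ n)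
    (hα : (k : ℝ≥0) * (n : ℝ≥0) ≤ α) :
    (((1 / 11520 : ℝ≥0) * (n : ℝ≥0) ^ (1 / (2 * (k : ℝ) - 2)) : ℝ≥0) : ℝ≥0∞) ≤
      priceOfAnarchy (Fin n) k α := by
  have : Nonempty (Fin n) := ⟨⟨0, by omega⟩⟩
  have hα' : (k : ℝ≥0) * (Fintype.card (Fin n) : ℝ≥0) ≤ α := by simpa using hα
  set N := n / 2 with hN
  have hN1 : 1 ≤ N := by omega
  have hn3 : n ≤ 3 * N := by omega
  set d := 2 * k - 2 with hd
  have hd2 : 2 ≤ d := by omega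
  have hexp : 1 / (2 * (k : ℝ) - 2) = ((d : ℝ))⁻¹ := by
    rw [hd, Nat.cast_sub (by omega)]; push_cast; rw [one_div]
  rw [hexp]
  set x : ℝ := (N : ℝ) ^ ((d : ℝ))⁻¹ with hx
  have hx0 : 0 ≤ x := by positivity
  have hxd : x ^ d = N := Real.rpow_inv_natCast_pow (by positivity) (by omega)
  have hnx : (n : ℝ) ^ ((d : ℝ))⁻¹ ≤ 3 * x := by
    have h3 : (3 : ℝ) ^ ((d : ℝ))⁻¹ ≤ 3 := by
      calc (3 : ℝ) ^ ((d : ℝ))⁻¹ ≤ (3 : ℝ) ^ (1 : ℝ) := by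
            apply Real.rpow_le_rpow_of_exponent_le (by norm_num)
            exact inv_le_one_of_one_le₀ (by exact_mod_cast (by omega : 1 ≤ d))
        _ = 3 := Real.rpow_one 3
    calc (n : ℝ) ^ ((d : ℝ))⁻¹ ≤ (3 * N : ℝ) ^ ((d : ℝ))⁻¹ := by
          apply Real.rpow_le_rpow (by positivity) (by exact_mod_cast hn3) (by positivity)
      _ = (3 : ℝ) ^ ((d : ℝ))⁻¹ * x := Real.mul_rpow (by norm_num) (by positivity)
      _ ≤ 3 * x := by gcongr
  have hnpos : (0 : ℝ) < n := by exact_mod_cast (by omega : 0 < n)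
  have hfinish : ∀ m : ℕ, (1 / 11520 : ℝ) * (3 * x) ≤ m / (2 * n) →
      ((1 / 11520 : ℝ≥0) * (n : ℝ≥0) ^ ((d : ℝ))⁻¹ : ℝ≥0) ≤
        (m : ℝ≥0) / ((2 * Fintype.card (Fin n) : ℕ) : ℝ≥0) := by
    intro m hm
    rw [← NNReal.coe_le_coe]
    push_cast
    rw [Fintype.card_fin]
    refine le_trans ?_ hm
    gcongr
  -- The threshold `960 = 3 · 320` ensures `T ≥ 3`. Below it the target is less than `3 · 960 /
  -- 11520 = 1/4`, and the star already gives `(n - 1) / (2n) ≥ 1/4`.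
  by_cases hT : x < 960
  · refine (ENNReal.coe_le_coe.2 (hfinish (n - 1) ?_)).trans
      (le_priceOfAnarchy hk hα' (star_isLKE (by omega) hα' ⟨0, by omega⟩) ?_)
    · rw [le_div_iff₀ (by positivity), Nat.cast_sub (by omega)]
      have : (2 : ℝ) ≤ n := by exact_mod_cast hn
      push_cast
      nlinarith
    · rw [sum_card_star, Fintype.card_fin]
  · push Not at hT
    set T := ⌊x / 320⌋₊ with hTdef
    have hT3 : 3 ≤ T := Nat.le_floor (by push_cast; linarith)
    have hTle : (320 * T : ℝ) ≤ x := by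
      have := Nat.floor_le (show 0 ≤ x / 320 by positivity)
      rw [← hTdef] at this
      linarith
    have hTlt : x < 320 * (T + 1) := by
      have := Nat.lt_floor_add_one (x / 320)
      rw [← hTdef] at this
      linarith
    have hpow : (320 * T) ^ (2 * k - 2) ≤ N := by
      have : ((320 * T : ℝ)) ^ d ≤ N := by
        rw [← hxd]
        gcongr
      exact_mod_cast this
    have hcount : ∀ s : Bool, N ≤ {v : Fin n | decide (v.val < N) = s}.ncard := by
      intro s
      have hN' : N + N ≤ n := by omega
      have hinj : ∀ (f : Fin N → Fin n), Function.Injective f →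
          (∀ i, decide ((f i).val < N) = s) → N ≤ {v : Fin n | decide (v.val < N) = s}.ncard := by
        intro f hf hfs
        have h1 := Set.ncard_le_ncard (s := Set.range f)
          (t := {v : Fin n | decide (v.val < N) = s}) (by rintro _ ⟨i, rfl⟩; exact hfs i)
          (Set.toFinite _)
        rwa [← Set.image_univ, Set.ncard_image_of_injective _ hf, Set.ncard_univ, Nat.card_fin] at h1
      cases s
      · exact hinj (fun i => ⟨N + i.val, by omega⟩) (fun i j h => by ext; simpa using h)
          (fun i => by simp)
      · exact hinj (fun i => ⟨i.val, by omega⟩) (fun i j h => by ext; simpa using h)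
          (fun i => by simp)
    obtain ⟨σ, hσ, hm⟩ := exists_isLKE_of_card (fun v : Fin n => decide (v.val < N)) hk hT3
      (hcount true) (hcount false) (by rw [Fintype.card_fin]; exact hn3) hpow hα'
    refine (ENNReal.coe_le_coe.2 (hfinish _ ?_)).trans (le_priceOfAnarchy hk hα' hσ hm)
    rw [le_div_iff₀ (by positivity)]
    have h1 : (3 : ℝ) ≤ T := by exact_mod_cast hT3
    have h2 : (n : ℝ) ≤ 3 * N := by exact_mod_cast hn3
    push_cast
    -- From `x < 320(T + 1) ≤ 640T` and `n ≤ 3N`; as `3 · 640 · 6 = 11520`, the middle term is `NT`.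
    calc 1 / 11520 * (3 * x) * (2 * (n : ℝ)) ≤ 1 / 11520 * (3 * (320 * (2 * T))) * (2 * (3 * N)) := by
          gcongr
          linarith
      _ ≤ 2 * N * T := by
          have : 0 ≤ (N : ℝ) * T := by positivity
          linarith

end SumNCG

theorem mainTheorem7 :
    ∃ c : ℝ≥0, 0 < c ∧ ∀ (k n : ℕ) (α : ℝ≥0), 2 ≤ k → 2 ≤ n → (k : ℝ≥0) * (n : ℝ≥0) ≤ α →
      ((c * (n : ℝ≥0) ^ (1 / (2 * (k : ℝ) - 2)) : ℝ≥0) : ℝ≥0∞) ≤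
        SumNCG.priceOfAnarchy (Fin n) k α := by
  exact ⟨1 / 11520, by positivity, fun k n α hk hn hα =>
    SumNCG.priceOfAnarchy_lower_bound hk hn hα⟩
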